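/- Let $\gamma>0$ and $\mu>0$. A bouncing ball is modelled, in dimensionless units, by two point masses at heights $x(t)$ (lower mass) and $y(t)$ (upper mass) subject to the constraint $x(t)\ge 0$; its state is $(x,\dot x,y,\dot y)\in\mathbb{R}^4$, and the possible initial conditions are the states with $x\ge 0$. While $x>0$ the motion obeys $$\ddot x+\mu\dot x+\tfrac12x=-\gamma-\tfrac12+\tfrac12y+\mu\dot y,\qquad \ddot y+\mu\dot y+\tfrac12y=-\gamma+\tfrac12+\tfrac12x+\mu\dot x .$$ At a contact time $t$, i.e. when $x(t)=0$, $x$, $y$ and $\dot y$ are continuous and $\dot x(t^+)=-\dot x(t^-)$. Immediately after a contact the lower mass either leaves the floor, or stays at rest on it; the latter is possible only as long as $F=\tfrac12y+\mu\dot y-\gamma-\tfrac12\le 0$, and during this time $\ddot y+\mu\dot y+\tfrac12y=-\gamma+\tfrac12$. Then the contacts of the lower mass with the floor are always instantaneous, in the sense that $x(t)=0$ implies $\lim_{s\to t^-}\dot x(s)\neq 0$ (at the initial time, the incoming velocity is that of the initial condition), except for the solutions generated by a set of initial conditions in $\mathbb{R}^4$ that has zero Lebesgue measure and is nowhere dense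 in the set $\{x\ge 0\}$ of all possible initial conditions. -/

import Mathlib

open Set Filter Topology MeasureTheory

namespace BouncingBall

/-- States of the ball, in dimensionless units: `u 0 = x` and `u 1 = ẋ` are the height and the
velocity of the lower point mass, `u 2 = y` and `u 3 = ẏ` those of the upper one. -/
abbrev State := Fin 4 → ℝ

/-- The vector field of the equations of motion when the ball is not in contact with the floor:
`ẍ + μ ẋ + x / 2 = -γ - 1 / 2 + y / 2 + μ ẏ` and `ÿ + μ ẏ + y / 2 = -γ + 1 / 2 + x / 2 + μ ẋ`. -/
noncomputable def freeField (γ μ : ℝ) (u : State) : State :=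
  ![u 1,
    -μ * u 1 - u 0 / 2 - γ - 1 / 2 + u 2 / 2 + μ * u 3,
    u 3,
    -μ * u 3 - u 2 / 2 - γ + 1 / 2 + u 0 / 2 + μ * u 1]

/-- The vector field while the lower point mass rests on the floor: `x` stays put and
`ÿ + μ ẏ + y / 2 = -γ + 1 / 2`. -/
noncomputable def stickyField (γ μ : ℝ) (u : State) : State :=
  ![0, 0, u 3, -μ * u 3 - u 2 / 2 - γ + 1 / 2]

/-- The force exerted by the spring and by gravity on the lower point mass resting on the floor. -/
noncomputable def floorForce (γ μ : ℝ) (u : State) : ℝ :=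
  u 2 / 2 + μ * u 3 - γ - 1 / 2

/-- The elastic collision rule: `ẋ` changes sign, everything else is kept. -/
def reflect (u : State) : State := ![u 0, -u 1, u 2, u 3]

open Classical in
/-- The state right after time `0`. An initial state on the floor that moves
downwards undergoes the collision at once. -/
noncomputable def startState (u₀ : State) : State :=
  if u₀ 0 = 0 ∧ u₀ 1 < 0 then reflect u₀ else u₀

/-- The possible initial conditions: the lower point mass is not below the floor. -/
def Admissible : Set State := {u₀ | 0 ≤ u₀ 0}

/-- `u` is a motion of the ball on the time interval `[0, T)` with initial condition `u₀`. The value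
`u t` at a time of contact is the state right after the contact. -/
structure IsTrajectory (γ μ : ℝ) (u₀ : State) (T : ℝ) (u : ℝ → State) : Prop where
  /-- The initial condition. -/
  init : u 0 = startState u₀
  /-- The constraint imposed by the floor. -/
  nonneg : ∀ t ∈ Ico 0 T, 0 ≤ u t 0
  /-- `u t` is the limit of the state from the right. -/
  right_cont : ∀ t ∈ Ico 0 T, ContinuousWithinAt u (Ici t) t
  /-- Above the floor the free equations of motion hold. -/
  free : ∀ t ∈ Ioo 0 T, 0 < u t 0 → HasDerivAt u (freeField γ μ (u t)) t
  /-- At a contact the one-sided limits of `x`, `y`, `ẏ` agree and those of `ẋ` are opposite. -/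
  contact : ∀ t ∈ Ioo 0 T, u t 0 = 0 → Tendsto u (𝓝[<] t) (𝓝 (reflect (u t)))
  /-- After a contact the lower point mass either leaves the floor, or rests on it for a while. The
  latter requires that the force on it points downwards (or vanishes), and then the upper point mass
  follows its own equation of motion. -/
  after_contact : ∀ t ∈ Ico 0 T, u t 0 = 0 → ∃ ε > 0,
    (∀ s ∈ Ioo t (t + ε), s < T → 0 < u s 0) ∨
    (∀ s ∈ Ioo t (t + ε), s < T → u s 0 = 0 ∧ u s 1 = 0 ∧ floorForce γ μ (u s) ≤ 0 ∧
      HasDerivAt u (stickyField γ μ (u s)) s)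

/-- At time `t` the lower point mass touches the floor with zero incoming velocity, that is `x t = 0`
and `ẋ s → 0` as `s → t⁻`. For a contact at the initial time, the incoming
velocity is the initial one. -/
def ZeroVelocityContactAt (u₀ : State) (u : ℝ → State) (t : ℝ) : Prop :=
  u t 0 = 0 ∧ ((t = 0 ∧ u₀ 1 = 0) ∨ (0 < t ∧ Tendsto (fun s => u s 1) (𝓝[<] t) (𝓝 0)))

/-- The initial conditions generating a motion (on whatever time interval) that has a contact with
zero velocity. -/
def anomalousInitialConditions (γ μ : ℝ) : Set State :=
  {u₀ | u₀ ∈ Admissible ∧ ∃ (T : ℝ) (u : ℝ → State), IsTrajectory γ μ u₀ T u ∧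
    ∃ t ∈ Ico 0 T, ZeroVelocityContactAt u₀ u t}

end BouncingBall

/-! The plan is to find an open set `G` that contains no anomalous initial condition and fills `{x >
0}` up to a null set. Both claims follow: `{x = 0}` is a null hyperplane, and the closure of the
anomalous set in `{x ≥ 0}` avoids `G`, hence contains no nonempty relatively open set.

Measure: a state whose free flight grazes the floor lies on a flow line through `{x = 0, ẋ = 0}`,
and these lines form the smooth image of a hyperplane. Going back through a collision with nonzero
velocity preserves nullity, because there the flow is transversal to the floor and time together
with the floor coordinates gives local coordinates. So the union of the sets `grazing γ μ k` is null
(`volume_grazing`), and any other airborne state generates an infinite chain of flights with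
transversal landings.

Openness is the real difficulty, since avoiding infinitely many grazings is not an open condition.
It is reduced to finitely many flights by dissipation. Once the energy is below a threshold, the
lower mass accelerates downwards throughout every flight, so all later landings are automatically
transversal. Having finitely many transversal flights followed by low energy is an open condition
(`isOpen_settling`).

It remains to show that every chain reaches low energy. First, contacts do not accumulate
(`false_of_tendsto`): near an accumulation time the lower mass is driven by the pressure `p` towards
the floor; if `p` is nonpositive the mass cannot come back, and if `p > 0` the quantity `x + ẋ² /
(2p)` decays at most exponentially, whereas shrinking flights would send it to zero. A chain
therefore lasts forever. Second, over some long window almost no energy is dissipated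
(`exists_energy_lt`); then the spring hardly changes length and the height is nearly a quadratic
polynomial in time. Being bounded on a long window, this polynomial has small coefficients, which
puts the ball near rest.

Finally, any motion in the sense of `IsTrajectory` follows the chain, so its contacts are exactly
the transversal ones. -/

namespace BouncingBall

/-! ### The free flow and its derivative -/

/-- The linear part of the free vector field. -/
noncomputable def freeLinear (μ : ℝ) : State →L[ℝ] State :=
  LinearMap.toContinuousLinearMap
    { toFun := fun u => ![u 1, -μ * u 1 - u 0 / 2 + u 2 / 2 + μ * u 3, u 3,
        -μ * u 3 - u 2 / 2 + u 0 / 2 + μ * u 1]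
      map_add' := by
        intro u v; ext i; fin_cases i <;> simp <;> ring
      map_smul' := by
        intro c u; ext i; fin_cases i <;> simp <;> ring }

theorem freeLinear_apply (μ : ℝ) (u : State) :
    freeLinear μ u = ![u 1, -μ * u 1 - u 0 / 2 + u 2 / 2 + μ * u 3, u 3,
        -μ * u 3 - u 2 / 2 + u 0 / 2 + μ * u 1] := rfl

theorem freeField_add (γ μ : ℝ) (u v : State) :
    freeField γ μ (u + v) = freeField γ μ u + freeLinear μ v := by
  rw [freeLinear_apply]
  ext i; fin_cases i <;> simp [freeField] <;> ring

theorem freeField_lipschitz (γ μ : ℝ) : LipschitzWith ‖freeLinear μ‖₊ (freeField γ μ) := by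
  have h : freeField γ μ = fun u => freeField γ μ 0 + freeLinear μ u := by
    ext1 u; rw [← freeField_add, zero_add]
  rw [h]
  refine LipschitzWith.of_dist_le_mul fun u v => ?_
  rw [dist_add_left]
  exact (freeLinear μ).lipschitz.dist_le_mul u v

/-- Free fall without oscillation. -/
noncomputable def fall (γ t : ℝ) : State :=
  ![-γ * t ^ 2 / 2, -γ * t, 1 - γ * t ^ 2 / 2, -γ * t]

/-- With the spring at natural length and equal velocities, spring and dashpot exert no force. This
particular solution reduces the affine equation to the linear group `exp (t • freeLinear μ)`. -/
theorem hasStrictDerivAt_fall (γ μ t : ℝ) :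
    HasStrictDerivAt (fall γ) (freeField γ μ (fall γ t)) t := by
  rw [hasStrictDerivAt_pi]
  have h1 : HasStrictDerivAt (fun s : ℝ => s) 1 t := hasStrictDerivAt_id t
  have h2 : HasStrictDerivAt (fun s : ℝ => -γ * s) (-γ) t := by
    simpa using h1.const_mul (-γ)
  have h3 : HasStrictDerivAt (fun s : ℝ => -γ * s ^ 2 / 2) (-γ * t) t := by
    refine (((h1.pow 2).const_mul (-γ)).div_const 2).congr_deriv ?_
    simp; ring
  have h4 : HasStrictDerivAt (fun s : ℝ => 1 - γ * s ^ 2 / 2) (-γ * t) t := by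
    refine ((((h1.pow 2).const_mul γ).div_const 2).const_sub 1).congr_deriv ?_
    simp; ring
  intro i
  fin_cases i
  · exact h3.congr_deriv (by simp [freeField, fall])
  · exact h2.congr_deriv (by simp [freeField, fall]; ring)
  · exact h4.congr_deriv (by simp [freeField, fall])
  · exact h2.congr_deriv (by simp [freeField, fall]; ring)

/-- The flow of the free equations of motion. -/
noncomputable def flow (γ μ t : ℝ) (u : State) : State :=
  fall γ t + NormedSpace.exp (t • freeLinear μ) (u - fall γ 0)

theorem flow_zero (γ μ : ℝ) (u : State) : flow γ μ 0 u = u := by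
  simp [flow]

theorem hasStrictFDerivAt_flow (γ μ t : ℝ) (u : State) :
    HasStrictFDerivAt (fun q : ℝ × State => flow γ μ q.1 q.2)
      ((ContinuousLinearMap.fst ℝ ℝ State).smulRight (freeField γ μ (flow γ μ t u)) +
        (NormedSpace.exp (t • freeLinear μ)).comp (ContinuousLinearMap.snd ℝ ℝ State)) (t, u) := by
  have h1 : HasStrictFDerivAt (fun q : ℝ × State => q.1) (ContinuousLinearMap.fst ℝ ℝ State)
      (t, u) := hasStrictFDerivAt_fst
  have h2 : HasStrictFDerivAt (fun q : ℝ × State => q.2 - fall γ 0)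
      (ContinuousLinearMap.snd ℝ ℝ State) (t, u) := hasStrictFDerivAt_snd.sub_const _
  have h3 := (hasStrictDerivAt_fall γ μ t).hasStrictFDerivAt.comp (t, u) h1
  have h4 := (hasStrictDerivAt_exp_smul_const (freeLinear μ) t).hasStrictFDerivAt.comp (t, u) h1
  have h5 := h3.add (h4.clm_apply h2)
  refine h5.congr_fderiv ?_
  refine ContinuousLinearMap.ext fun ⟨s, v⟩ => ?_
  have : freeField γ μ (flow γ μ t u) = freeField γ μ (fall γ t) +
      NormedSpace.exp (t • freeLinear μ) (freeLinear μ (u - fall γ 0)) := by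
    rw [flow, freeField_add]
    have hc : Commute (NormedSpace.exp (t • freeLinear μ)) (freeLinear μ) :=
      ((Commute.refl (freeLinear μ)).smul_left t).exp_left
    congr 1
    exact (DFunLike.congr_fun hc.eq (u - fall γ 0)).symm
  rw [this]
  simp only [ContinuousLinearMap.comp_apply, add_apply,
    ContinuousLinearMap.flip_apply, ContinuousLinearMap.smulRight_apply,
    ContinuousLinearMap.coe_fst', ContinuousLinearMap.coe_snd',
    ContinuousLinearMap.toSpanSingleton_apply, smul_apply,
    mul_apply_eq_comp, smul_add]
  abel

theorem continuous_flow (γ μ : ℝ) : Continuous (fun q : ℝ × State => flow γ μ q.1 q.2) :=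
  continuous_iff_continuousAt.2 fun q => (hasStrictFDerivAt_flow γ μ q.1 q.2).continuousAt

theorem hasDerivAt_flow (γ μ t : ℝ) (u : State) :
    HasDerivAt (fun s => flow γ μ s u) (freeField γ μ (flow γ μ t u)) t := by
  have h := (hasStrictFDerivAt_flow γ μ t u).hasFDerivAt.comp_hasDerivAt t
    ((hasDerivAt_id t).prodMk (hasDerivAt_const t u))
  exact h.congr_deriv (by simp)

theorem flow_unique {γ μ a b : ℝ} {f : ℝ → State} (hc : ContinuousOn f (Icc a b))
    (hf : ∀ t ∈ Ico a b, HasDerivWithinAt f (freeField γ μ (f t)) (Ici t) t) :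
    ∀ t ∈ Icc a b, f t = flow γ μ (t - a) (f a) := by
  have hd : ∀ t, HasDerivAt (fun t => flow γ μ (t - a) (f a))
      (freeField γ μ (flow γ μ (t - a) (f a))) t := fun t =>
    (hasDerivAt_flow γ μ (t - a) (f a)).comp_sub_const t a
  refine ODE_solution_unique (v := fun _ => freeField γ μ) (fun _ => freeField_lipschitz γ μ) hc hf
    (fun t _ => (hd t).continuousAt.continuousWithinAt) (fun t _ => (hd t).hasDerivWithinAt) ?_
  simp [flow_zero]

theorem flow_add (γ μ s t : ℝ) (u : State) :
    flow γ μ (t + s) u = flow γ μ t (flow γ μ s u) := by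
  have h := ODE_solution_unique_univ (v := fun _ => freeField γ μ) (s := fun _ => univ)
    (K := ‖freeLinear μ‖₊)
    (f := fun t => flow γ μ (t + s) u) (g := fun t => flow γ μ t (flow γ μ s u)) (t₀ := 0)
    (fun _ => (freeField_lipschitz γ μ).lipschitzOnWith)
    (fun t => ⟨(hasDerivAt_flow γ μ (t + s) u).comp_add_const t s, mem_univ _⟩)
    (fun t => ⟨hasDerivAt_flow γ μ t _, mem_univ _⟩) (by simp [flow_zero])
  exact congrFun h t

theorem flow_neg_flow (γ μ t : ℝ) (u : State) : flow γ μ (-t) (flow γ μ t u) = u := by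
  rw [← flow_add, neg_add_cancel, flow_zero]

/-- Differentiate the commutation of the flows at times `s` and `t` at `s = 0`: the linearized flow
transports the vector field along orbits. -/
theorem exp_freeLinear_freeField (γ μ t : ℝ) (u : State) :
    NormedSpace.exp (t • freeLinear μ) (freeField γ μ u) = freeField γ μ (flow γ μ t u) := by
  have h1 : HasDerivAt (fun s => flow γ μ t (flow γ μ s u))
      (NormedSpace.exp (t • freeLinear μ) (freeField γ μ u)) 0 := by
    have h := hasDerivAt_flow γ μ 0 u
    rw [flow_zero] at h
    have := (hasStrictFDerivAt_flow γ μ t (flow γ μ 0 u)).hasFDerivAt.comp_hasDerivAt (0 : ℝ)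
      ((hasDerivAt_const (0 : ℝ) t).prodMk h)
    exact this.congr_deriv (by simp)
  have h2 : HasDerivAt (fun s => flow γ μ (s + t) u) (freeField γ μ (flow γ μ t u)) 0 := by
    have h := hasDerivAt_flow γ μ (0 + t) u
    have := h.comp_add_const 0 t
    simpa using this
  refine h1.unique (h2.congr_of_eventuallyEq (Eventually.of_forall fun s => ?_))
  simp only [← flow_add]
  rw [add_comm]

theorem exp_freeLinear_injective (μ t : ℝ) :
    Function.Injective (NormedSpace.exp (t • freeLinear μ) : State →L[ℝ] State) := by
  intro x y hxy
  have key : ∀ z, NormedSpace.exp (t • freeLinear μ) z = flow 0 μ t (z + fall 0 0) - fall 0 t := by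
    intro z; simp [flow]
  rw [key, key, sub_left_inj] at hxy
  have h := congrArg (flow 0 μ (-t)) hxy
  rwa [flow_neg_flow, flow_neg_flow, add_left_inj] at h

/-! ### Flow coordinates based on the floor -/

/-- The free motion at time `p 0` that starts on the floor with the other coordinates of `p`. -/
noncomputable def fromFloor (γ μ : ℝ) (p : State) : State :=
  flow γ μ (p 0) (Function.update p 0 0)

/-- The projection onto the states on the floor. -/
noncomputable def ontoFloor : State →L[ℝ] State :=
  LinearMap.toContinuousLinearMap
    { toFun := fun p => Function.update p 0 0
      map_add' := by
        intro u v; ext i; fin_cases i <;> simp [Function.update]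
      map_smul' := by
        intro c u; ext i; fin_cases i <;> simp [Function.update] }

theorem ontoFloor_apply (p : State) : ontoFloor p = Function.update p 0 0 := rfl

theorem hasStrictFDerivAt_fromFloor (γ μ : ℝ) (p : State) :
    HasStrictFDerivAt (fromFloor γ μ)
      (((ContinuousLinearMap.proj 0 : State →L[ℝ] ℝ).smulRight
        (freeField γ μ (fromFloor γ μ p))) +
        (NormedSpace.exp (p 0 • freeLinear μ)).comp ontoFloor) p := by
  have h1 : HasStrictFDerivAt (fun q : State => (q 0, ontoFloor q))
      ((ContinuousLinearMap.proj 0 : State →L[ℝ] ℝ).prod ontoFloor) p :=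
    ((ContinuousLinearMap.proj 0 : State →L[ℝ] ℝ).hasStrictFDerivAt).prodMk
      ontoFloor.hasStrictFDerivAt
  have h2 := (hasStrictFDerivAt_flow γ μ (p 0) (ontoFloor p)).comp p h1
  refine h2.congr_fderiv ?_
  ext1 v
  rfl

/-- After the invertible linearized flow is factored out, what remains is the field at a floor state
plus the floor directions. The field has height component `p 1 ≠ 0`, so it is transversal to them.
-/
theorem fromFloor_deriv_injective (γ μ : ℝ) (p : State) (hp : p 1 ≠ 0) :
    Function.Injective (((ContinuousLinearMap.proj 0 : State →L[ℝ] ℝ).smulRight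
        (freeField γ μ (fromFloor γ μ p))) +
        (NormedSpace.exp (p 0 • freeLinear μ)).comp ontoFloor : State →L[ℝ] State) := by
  rw [injective_iff_map_eq_zero]
  intro v hv
  have h1 : NormedSpace.exp (p 0 • freeLinear μ)
      (v 0 • freeField γ μ (ontoFloor p) + ontoFloor v) = 0 := by
    rw [map_add, map_smul, exp_freeLinear_freeField]
    exact hv
  have h2 : v 0 • freeField γ μ (ontoFloor p) + ontoFloor v = 0 :=
    exp_freeLinear_injective μ (p 0) (by rw [h1, map_zero])
  have h3 : v 0 = 0 := by
    have := congrFun h2 0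
    simpa [freeField, ontoFloor_apply, hp] using this
  rw [h3, zero_smul, zero_add, ontoFloor_apply] at h2
  rw [← h2, ← h3, Function.update_eq_self]

/-- A set is null if it is mapped to a null set by a map that is a local diffeomorphism at each of
its points. -/
theorem null_of_null_image {E : Type*} [NormedAddCommGroup E] [NormedSpace ℝ E]
    [FiniteDimensional ℝ E] [MeasurableSpace E] [BorelSpace E] (ν : Measure E)
    [ν.IsAddHaarMeasure] {f : E → E} {f' : E → E →L[ℝ] E} {s : Set E}
    (hf : ∀ x ∈ s, HasStrictFDerivAt f (f' x) x) (hi : ∀ x ∈ s, Function.Injective (f' x))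
    (h0 : ν (f '' s) = 0) : ν s = 0 := by
  have : CompleteSpace E := FiniteDimensional.complete ℝ E
  refine measure_null_of_locally_null s fun x hx => ?_
  let e : E ≃L[ℝ] E :=
    (LinearEquiv.ofInjectiveEndo (f' x : E →ₗ[ℝ] E) (hi x hx)).toContinuousLinearEquiv
  have he : HasStrictFDerivAt f (e : E →L[ℝ] E) x := by
    refine (hf x hx).congr_fderiv ?_
    ext v; rfl
  let φ := he.toOpenPartialHomeomorph f
  have hxs : φ.source ∈ 𝓝 x := φ.open_source.mem_nhds he.mem_toOpenPartialHomeomorph_source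
  refine ⟨s ∩ φ.source, inter_mem_nhdsWithin s hxs, ?_⟩
  have himg : s ∩ φ.source = φ.symm '' (f '' (s ∩ φ.source)) := by
    rw [image_image]
    refine ((image_congr fun y hy => ?_).trans (image_id _)).symm
    exact φ.left_inv hy.2
  rw [himg]
  refine addHaar_image_eq_zero_of_differentiableOn_of_addHaar_eq_zero ν ?_
    (measure_mono_null (image_mono inter_subset_left) h0)
  rintro _ ⟨y, ⟨hys, hyφ⟩, rfl⟩
  let ey : E ≃L[ℝ] E :=
    (LinearEquiv.ofInjectiveEndo (f' y : E →ₗ[ℝ] E) (hi y hys)).toContinuousLinearEquiv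
  have hey : HasFDerivAt f (ey : E →L[ℝ] E) y := by
    refine (hf y hys).hasFDerivAt.congr_fderiv ?_
    ext v; rfl
  refine (φ.hasFDerivAt_symm (f' := ey) (φ.map_source hyφ)
    ?_).differentiableAt.differentiableWithinAt
  rw [φ.left_inv hyφ]
  exact hey

/-! ### The collision map and the null sets of grazing states -/

@[simp] theorem reflect_zero (u : State) : reflect u 0 = u 0 := rfl
@[simp] theorem reflect_one (u : State) : reflect u 1 = -u 1 := rfl
@[simp] theorem reflect_two (u : State) : reflect u 2 = u 2 := rfl
@[simp] theorem reflect_three (u : State) : reflect u 3 = u 3 := rfl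

theorem reflect_reflect (u : State) : reflect (reflect u) = u := by
  ext i; fin_cases i <;> simp [reflect]

theorem differentiable_reflect : Differentiable ℝ reflect := by
  rw [differentiable_pi]
  intro i
  fin_cases i <;> simp [reflect] <;> fun_prop

theorem continuous_reflect : Continuous reflect := differentiable_reflect.continuous

theorem volume_coordinate_eq (i : Fin 4) (c : ℝ) : volume {p : State | p i = c} = 0 := by
  rw [volume_pi]
  exact Measure.pi_hyperplane (fun _ : Fin 4 => (volume : Measure ℝ)) i c

theorem differentiable_fromFloor (γ μ : ℝ) : Differentiable ℝ (fromFloor γ μ) := fun p =>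
  (hasStrictFDerivAt_fromFloor γ μ p).hasFDerivAt.differentiableAt

/-- The height of a floor state carries no information, so its slot is reused for the time; this
makes `fromFloor` a self-map of `State`, for which null sets can be compared. -/
theorem fromFloor_update (γ μ t : ℝ) {u : State} (h : u 0 = 0) :
    fromFloor γ μ (Function.update u 0 t) = flow γ μ t u := by
  rw [fromFloor]
  congr 1
  rw [Function.update_idem, ← h, Function.update_eq_self]

/-- The states whose free motion, once the transversal collisions at `k` heights `x = 0` are taken
into account, touches the floor with zero velocity. -/
def grazing (γ μ : ℝ) : ℕ → Set State
  | 0 => {z | ∃ t u, u 0 = 0 ∧ u 1 = 0 ∧ flow γ μ t u = z}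
  | k + 1 => {z | ∃ t, ∃ u ∈ grazing γ μ k, u 0 = 0 ∧ u 1 ≠ 0 ∧ flow γ μ t (reflect u) = z}

theorem flow_mem_grazing {γ μ : ℝ} {k : ℕ} {z : State} (hz : z ∈ grazing γ μ k) (t : ℝ) :
    flow γ μ t z ∈ grazing γ μ k := by
  cases k with
  | zero =>
    obtain ⟨s, u, h0, h1, rfl⟩ := hz
    exact ⟨t + s, u, h0, h1, flow_add γ μ s t u⟩
  | succ k =>
    obtain ⟨s, u, hu, h0, h1, rfl⟩ := hz
    exact ⟨t + s, u, hu, h0, h1, flow_add γ μ s t _⟩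

/-- The base case is the differentiable image of the hyperplane `p 1 = 0`. In the induction step,
pull the null set back by `fromFloor`, a local diffeomorphism where `p 1 ≠ 0`, then push it forward
by the differentiable map `fromFloor ∘ reflect`. -/
theorem volume_grazing (γ μ : ℝ) (k : ℕ) : volume (grazing γ μ k) = 0 := by
  induction k with
  | zero =>
    have h : grazing γ μ 0 ⊆ fromFloor γ μ '' {p | p 1 = 0} := by
      rintro _ ⟨t, u, h0, h1, rfl⟩
      exact ⟨Function.update u 0 t, by simpa using h1, fromFloor_update γ μ t h0⟩
    exact measure_mono_null h (addHaar_image_eq_zero_of_differentiableOn_of_addHaar_eq_zero volume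
      (differentiable_fromFloor γ μ).differentiableOn (volume_coordinate_eq 1 0))
  | succ k ih =>
    have h1 : volume {p : State | p 1 ≠ 0 ∧ fromFloor γ μ p ∈ grazing γ μ k} = 0 := by
      refine null_of_null_image volume (fun p _ => hasStrictFDerivAt_fromFloor γ μ p)
        (fun p hp => fromFloor_deriv_injective γ μ p hp.1) (measure_mono_null ?_ ih)
      rintro _ ⟨p, hp, rfl⟩
      exact hp.2
    have h2 := addHaar_image_eq_zero_of_differentiableOn_of_addHaar_eq_zero volume
      ((differentiable_fromFloor γ μ).comp differentiable_reflect).differentiableOn h1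
    refine measure_mono_null ?_ h2
    rintro _ ⟨t, u, hu, h0, h1, rfl⟩
    -- The same `t` serves before and after the reflection; this is harmless because `grazing γ μ k`
    -- is invariant under the flow.
    refine ⟨Function.update u 0 t, ⟨by simpa using h1, ?_⟩, ?_⟩
    · rw [fromFloor_update γ μ t h0]
      exact flow_mem_grazing hu t
    · have h3 : reflect (Function.update u 0 t) = Function.update (reflect u) 0 t := by
        ext i; fin_cases i <;> simp [reflect]
      rw [Function.comp_apply, h3, fromFloor_update γ μ t (by simpa using h0)]

/-! ### Energy and its dissipation -/

/-- The elongation of the spring with respect to its length when the ball rests on the floor. -/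
def stretch (γ : ℝ) (u : State) : ℝ := u 2 - u 0 - 1 + 2 * γ

/-- The mechanical energy, normalized so that it vanishes when the ball rests on the floor. -/
noncomputable def energy (γ : ℝ) (u : State) : ℝ :=
  u 1 ^ 2 / 2 + u 3 ^ 2 / 2 + stretch γ u ^ 2 / 4 + 2 * γ * u 0

/-- The acceleration of the lower mass. -/
noncomputable def accel (γ μ : ℝ) (u : State) : ℝ :=
  stretch γ u / 2 - 2 * γ + μ * (u 3 - u 1)

section derivatives

variable {γ μ t : ℝ} {f : ℝ → State} {S : Set ℝ}

theorem hasDerivWithinAt_height (h : HasDerivWithinAt f (freeField γ μ (f t)) S t) :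
    HasDerivWithinAt (fun s => f s 0) (f t 1) S t := by
  simpa [freeField] using (hasDerivWithinAt_pi.1 h) 0

theorem hasDerivWithinAt_velocity (h : HasDerivWithinAt f (freeField γ μ (f t)) S t) :
    HasDerivWithinAt (fun s => f s 1) (accel γ μ (f t)) S t := by
  refine ((hasDerivWithinAt_pi.1 h) 1).congr_deriv ?_
  simp [freeField, accel, stretch]; ring

theorem hasDerivWithinAt_upper_velocity (h : HasDerivWithinAt f (freeField γ μ (f t)) S t) :
    HasDerivWithinAt (fun s => f s 3) (-stretch γ (f t) / 2 - μ * (f t 3 - f t 1)) S t := by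
  refine ((hasDerivWithinAt_pi.1 h) 3).congr_deriv ?_
  simp [freeField, stretch]; ring

theorem hasDerivWithinAt_stretch (h : HasDerivWithinAt f (freeField γ μ (f t)) S t) :
    HasDerivWithinAt (fun s => stretch γ (f s)) (f t 3 - f t 1) S t := by
  have h2 : HasDerivWithinAt (fun s => f s 2) (f t 3) S t := by
    simpa [freeField] using (hasDerivWithinAt_pi.1 h) 2
  exact ((h2.sub (hasDerivWithinAt_height h)).sub_const 1).add_const (2 * γ)

/-- Spring and gravity are conservative, so only the dashpot contributes, through the relative
velocity. -/
theorem hasDerivWithinAt_energy (h : HasDerivWithinAt f (freeField γ μ (f t)) S t) :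
    HasDerivWithinAt (fun s => energy γ (f s)) (-μ * (f t 3 - f t 1) ^ 2) S t := by
  have h1 := ((hasDerivWithinAt_velocity h).pow 2).div_const 2
  have h2 := ((hasDerivWithinAt_upper_velocity h).pow 2).div_const 2
  have h3 := ((hasDerivWithinAt_stretch h).pow 2).div_const 4
  have h4 := (hasDerivWithinAt_height h).const_mul (2 * γ)
  refine (((h1.add h2).add h3).add h4).congr_deriv ?_
  simp only [accel]; push_cast; ring

end derivatives

theorem flow_hasDerivWithinAt (γ μ t : ℝ) (u : State) (S : Set ℝ) :
    HasDerivWithinAt (fun s => flow γ μ s u) (freeField γ μ (flow γ μ t u)) S t :=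
  (hasDerivAt_flow γ μ t u).hasDerivWithinAt

theorem continuous_flow_time (γ μ : ℝ) (u : State) : Continuous fun t => flow γ μ t u :=
  (continuous_flow γ μ).comp (continuous_id.prodMk continuous_const)

theorem continuous_flow_coord (γ μ : ℝ) (u : State) (i : Fin 4) :
    Continuous fun t => flow γ μ t u i :=
  (continuous_apply i).comp (continuous_flow_time γ μ u)

theorem continuous_stretch (γ : ℝ) : Continuous (stretch γ) := by
  unfold stretch; fun_prop

theorem continuous_energy (γ : ℝ) : Continuous (energy γ) := by
  unfold energy stretch; fun_prop

theorem energy_reflect (γ : ℝ) (u : State) : energy γ (reflect u) = energy γ u := by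
  simp [energy, stretch]

theorem stretch_reflect (γ : ℝ) (u : State) : stretch γ (reflect u) = stretch γ u := by
  simp [stretch]

theorem energy_flow_antitone {γ μ : ℝ} (hμ : 0 < μ) (u : State) :
    Antitone fun t => energy γ (flow γ μ t u) := by
  have h : ∀ t, HasDerivAt (fun t => energy γ (flow γ μ t u))
      (-μ * (flow γ μ t u 3 - flow γ μ t u 1) ^ 2) t := fun t =>
    (hasDerivWithinAt_energy (flow_hasDerivWithinAt γ μ t u univ)).hasDerivAt univ_mem
  refine antitone_of_hasDerivAt_nonpos h fun t => ?_
  have := mul_nonneg hμ.le (sq_nonneg (flow γ μ t u 3 - flow γ μ t u 1))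
  simpa using this

theorem abs_stretch_le {γ : ℝ} (hγ : 0 < γ) {u : State} (hu : 0 ≤ u 0) :
    |stretch γ u| ≤ energy γ u + 1 := by
  have h := mul_nonneg hγ.le hu
  rw [abs_le]; unfold energy
  constructor <;> nlinarith [sq_nonneg (u 1), sq_nonneg (u 3), sq_nonneg (stretch γ u - 2),
    sq_nonneg (stretch γ u + 2)]

/-! ### Flights and chains of flights -/

/-- The states in which the lower mass is off the floor, or moves upwards. -/
def airborne : Set State := {u | 0 < u 0 ∨ 0 < u 1}

theorem isOpen_airborne : IsOpen airborne :=
  (isOpen_lt continuous_const (continuous_apply 0)).union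
    (isOpen_lt continuous_const (continuous_apply 1))

/-- Zero is a barrier: at height zero an airborne state moves upwards. -/
theorem flow_height_nonneg {γ μ τ : ℝ} {u : State} (hu : 0 ≤ u 0)
    (h : ∀ s ∈ Ico 0 τ, flow γ μ s u ∈ airborne) : ∀ s ∈ Icc 0 τ, 0 ≤ flow γ μ s u 0 := by
  intro s hs
  have key := image_le_of_deriv_right_lt_deriv_boundary (f := fun s => -flow γ μ s u 0)
    (f' := fun s => -flow γ μ s u 1) (a := 0) (b := τ) (B := fun _ => 0) (B' := fun _ => 0)
    (continuous_flow_coord γ μ u 0).neg.continuousOn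
    (fun x _ => (hasDerivWithinAt_height (flow_hasDerivWithinAt γ μ x u _)).neg)
    (by simpa [flow_zero] using hu) (fun x => hasDerivAt_const x 0)
    (fun x hx hx0 => by
      rcases h x hx with h1 | h1
      · linarith
      · linarith) hs
  simpa using key

/-- A free motion on `[0, τ]` that ends with a transversal collision, and is off the floor before. -/
structure IsFlight (γ μ : ℝ) (u : State) (τ : ℝ) : Prop where
  pos : 0 < τ
  mem : ∀ s ∈ Ico 0 τ, flow γ μ s u ∈ airborne
  floor : flow γ μ τ u 0 = 0
  down : flow γ μ τ u 1 < 0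

/-- An interior zero of the height would be a local minimum, hence have zero velocity, and such a
state is not airborne. -/
theorem flow_height_pos {γ μ τ : ℝ} {u : State} (hu : 0 ≤ u 0)
    (h : ∀ s ∈ Ico 0 τ, flow γ μ s u ∈ airborne) : ∀ s ∈ Ioo 0 τ, 0 < flow γ μ s u 0 := by
  intro s hs
  have h0 := flow_height_nonneg hu h
  refine lt_of_le_of_ne (h0 s ⟨hs.1.le, hs.2.le⟩) fun h1 => ?_
  have hmin : IsLocalMin (fun s => flow γ μ s u 0) s := by
    filter_upwards [Ioo_mem_nhds hs.1 hs.2] with r hr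
    rw [← h1]
    exact h0 r ⟨hr.1.le, hr.2.le⟩
  have hd := (hasDerivWithinAt_height (flow_hasDerivWithinAt γ μ s u univ)).hasDerivAt univ_mem
  have h2 := hmin.hasDerivAt_eq_zero hd
  rcases h s ⟨hs.1.le, hs.2⟩ with h3 | h3
  · exact h3.ne h1
  · exact h3.ne' h2

/-- The centre of mass follows a falling parabola, while the energy bounds the elongation of the
spring as long as the height is nonnegative; so the lower mass must fall too. -/
theorem exists_flow_height_neg {γ μ : ℝ} (hγ : 0 < γ) (hμ : 0 < μ) (u : State) :
    ∃ s ≥ 0, flow γ μ s u 0 < 0 := by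
  by_contra! hcon
  have h1 : ∀ s, flow γ μ s u 1 + flow γ μ s u 3 + 2 * γ * s = u 1 + u 3 := by
    have hd : ∀ s, HasDerivAt (fun s => flow γ μ s u 1 + flow γ μ s u 3 + 2 * γ * s) 0 s := by
      intro s
      have h1 := (hasDerivWithinAt_velocity (flow_hasDerivWithinAt γ μ s u univ)).hasDerivAt
        univ_mem
      have h3 := (hasDerivWithinAt_upper_velocity (flow_hasDerivWithinAt γ μ s u univ)).hasDerivAt
        univ_mem
      refine ((h1.add h3).add ((hasDerivAt_id s).const_mul (2 * γ))).congr_deriv ?_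
      simp only [accel]; ring
    intro s
    have := is_const_of_deriv_eq_zero (fun s => (hd s).differentiableAt) (fun s => (hd s).deriv) s 0
    simpa [flow_zero] using this
  have h2 : ∀ s, 2 * flow γ μ s u 0 + stretch γ (flow γ μ s u) - (u 1 + u 3) * s + γ * s ^ 2 =
      2 * u 0 + stretch γ u := by
    have hd : ∀ s, HasDerivAt (fun s => 2 * flow γ μ s u 0 + stretch γ (flow γ μ s u) -
        (u 1 + u 3) * s + γ * s ^ 2) 0 s := by
      intro s
      have hx := (hasDerivWithinAt_height (flow_hasDerivWithinAt γ μ s u univ)).hasDerivAt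
        univ_mem
      have hs := (hasDerivWithinAt_stretch (flow_hasDerivWithinAt γ μ s u univ)).hasDerivAt
        univ_mem
      refine ((((hx.const_mul 2).add hs).sub ((hasDerivAt_id s).const_mul (u 1 + u 3))).add
        (((hasDerivAt_id s).pow 2).const_mul γ)).congr_deriv ?_
      simp; linarith [h1 s]
    intro s
    have := is_const_of_deriv_eq_zero (fun s => (hd s).differentiableAt) (fun s => (hd s).deriv) s 0
    simpa [flow_zero] using this
  set a := |2 * u 0 + stretch γ u| with ha
  set b := |u 1 + u 3| with hb
  have hE : 0 ≤ energy γ u := by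
    have : 0 ≤ u 0 := by simpa [flow_zero] using hcon 0 le_rfl
    have := mul_nonneg hγ.le this
    unfold energy; positivity
  -- At this time `γ * s ^ 2` exceeds all the other terms of the identity `h2`, given `s ≥ 1`.
  set s := 1 + (a + b + energy γ u + 2) / γ with hs
  have ha0 : 0 ≤ a := abs_nonneg _
  have hb0 : 0 ≤ b := abs_nonneg _
  have hs1 : 1 ≤ s := by
    have : 0 ≤ (a + b + energy γ u + 2) / γ := by positivity
    linarith
  have hγs : γ * s = γ + (a + b + energy γ u + 2) := by
    rw [hs]; field_simp
  have h3 := abs_le.1 (abs_stretch_le hγ (hcon s (by linarith)))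
  have h4 : energy γ (flow γ μ s u) ≤ energy γ u := by
    have := energy_flow_antitone (γ := γ) hμ u (show 0 ≤ s by linarith)
    simpa [flow_zero] using this
  have h5 := h2 s
  have h6 := hcon s (by linarith)
  have h7 := le_abs_self (2 * u 0 + stretch γ u)
  have h8 := le_abs_self (u 1 + u 3)
  have h9 : (u 1 + u 3) * s ≤ b * s := mul_le_mul_of_nonneg_right h8 (by linarith)
  have h10 : γ * s ^ 2 = γ * s + (a + b + energy γ u + 2) * s := by
    linear_combination s * hγs
  nlinarith [mul_nonneg ha0 (show 0 ≤ s - 1 by linarith),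
    mul_nonneg hE (show 0 ≤ s - 1 by linarith)]

/-- Take the first exit time from the open set `airborne`. Using this set rather than `{x > 0}`
allows starts on the floor with upward velocity. -/
theorem exists_return {γ μ : ℝ} (hγ : 0 < γ) (hμ : 0 < μ) {u : State} (hu : 0 ≤ u 0)
    (hua : u ∈ airborne) : ∃ τ > 0, (∀ s ∈ Ico 0 τ, flow γ μ s u ∈ airborne) ∧
      flow γ μ τ u 0 = 0 ∧ flow γ μ τ u 1 ≤ 0 := by
  let S := {s : ℝ | 0 ≤ s ∧ flow γ μ s u ∉ airborne}
  have hne : S.Nonempty := by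
    obtain ⟨s, hs0, hs⟩ := exists_flow_height_neg hγ hμ u
    by_contra hS
    have h : ∀ r ∈ Ico 0 s, flow γ μ r u ∈ airborne := by
      intro r hr
      by_contra hr2
      exact hS ⟨r, hr.1, hr2⟩
    exact absurd (flow_height_nonneg hu h s ⟨hs0, le_rfl⟩) (not_le.2 hs)
  have hbdd : BddBelow S := ⟨0, fun s hs => hs.1⟩
  have hcl : IsClosed S := isClosed_Ici.inter
    (isOpen_airborne.isClosed_compl.preimage (continuous_flow_time γ μ u))
  have hmem : sInf S ∈ S := hcl.csInf_mem hne hbdd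
  have hbefore : ∀ s ∈ Ico 0 (sInf S), flow γ μ s u ∈ airborne := by
    intro s hs
    by_contra h
    exact absurd (csInf_le hbdd ⟨hs.1, h⟩) (not_le.2 hs.2)
  have hnot : ¬ (0 < flow γ μ (sInf S) u 0 ∨ 0 < flow γ μ (sInf S) u 1) := hmem.2
  push Not at hnot
  refine ⟨sInf S, lt_of_le_of_ne hmem.1 fun h => ?_, hbefore, ?_, hnot.2⟩
  · have := hmem.2
    rw [← h, flow_zero] at this
    exact this hua
  · exact le_antisymm hnot.1 (flow_height_nonneg hu hbefore _ ⟨hmem.1, le_rfl⟩)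

/-- A sequence of flights separated by collisions: `u n` is the state at the beginning of the
`n`-th flight, and `τ n` is its duration. -/
structure IsChain (γ μ : ℝ) (u : ℕ → State) (τ : ℕ → ℝ) : Prop where
  flight : ∀ n, IsFlight γ μ (u n) (τ n)
  next : ∀ n, u (n + 1) = reflect (flow γ μ (τ n) (u n))
  nonneg : 0 ≤ u 0 0

theorem exists_chain {γ μ : ℝ} {S : Set State}
    (h : ∀ u ∈ S, ∃ τ, IsFlight γ μ u τ ∧ reflect (flow γ μ τ u) ∈ S) {u₀ : State} (hu : u₀ ∈ S)
    (h0 : 0 ≤ u₀ 0) : ∃ u τ, IsChain γ μ u τ ∧ u 0 = u₀ := by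
  choose! τ hτ hS using h
  let u : ℕ → State := fun n => (fun v => reflect (flow γ μ (τ v) v))^[n] u₀
  have hsucc : ∀ n, u (n + 1) = reflect (flow γ μ (τ (u n)) (u n)) := fun n =>
    Function.iterate_succ_apply' _ _ _
  have hmem : ∀ n, u n ∈ S := by
    intro n
    induction n with
    | zero => exact hu
    | succ n ih => rw [hsucc]; exact hS _ ih
  exact ⟨u, fun n => τ (u n), ⟨fun n => hτ _ (hmem n), hsucc, h0⟩, rfl⟩

theorem reflect_mem_airborne {γ μ τ : ℝ} {u : State} (h : IsFlight γ μ u τ) :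
    reflect (flow γ μ τ u) ∈ airborne := by
  right; simpa using h.down

/-- The grazing sets are defined by running backwards: a grazing landing would put the state in
`grazing γ μ 0`, and a successor in `grazing γ μ k` would put it in `grazing γ μ (k + 1)`. -/
theorem exists_chain_of_not_grazing {γ μ : ℝ} (hγ : 0 < γ) (hμ : 0 < μ) {u₀ : State}
    (h0 : 0 ≤ u₀ 0) (ha : u₀ ∈ airborne) (hg : ∀ k, u₀ ∉ grazing γ μ k) :
    ∃ u τ, IsChain γ μ u τ ∧ u 0 = u₀ := by
  refine exists_chain (S := {u | 0 ≤ u 0 ∧ u ∈ airborne ∧ ∀ k, u ∉ grazing γ μ k}) ?_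
    ⟨h0, ha, hg⟩ h0
  rintro u ⟨hu0, hua, hug⟩
  obtain ⟨τ, hτ, hmem, hfl, hdown⟩ := exists_return hγ hμ hu0 hua
  have hne : flow γ μ τ u 1 ≠ 0 := fun h =>
    hug 0 ⟨-τ, flow γ μ τ u, hfl, h, flow_neg_flow γ μ τ u⟩
  have hfli : IsFlight γ μ u τ := ⟨hτ, hmem, hfl, lt_of_le_of_ne hdown hne⟩
  refine ⟨τ, hfli, by simp [hfl], reflect_mem_airborne hfli, fun k hk => hug (k + 1) ?_⟩
  refine ⟨-τ, _, hk, by simpa using hfl, by simpa using hne, ?_⟩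
  rw [reflect_reflect, flow_neg_flow]

/-! ### Automatic transversality at low energy -/

theorem exists_energy_lt_accel_neg {γ μ : ℝ} (hγ : 0 < γ) (hμ : 0 < μ) :
    ∃ δ > 0, ∀ u : State, 0 ≤ u 0 → energy γ u < δ → accel γ μ u < 0 := by
  -- If both velocities and the stretch are below `c` in absolute value, spring and dashpot
  -- contribute less than `c / 2 + 2 * μ * c < γ`, which cannot offset `-2 * γ`.
  set c := γ / (1 + 2 * μ) with hc
  have hc0 : 0 < c := by positivity
  have hcγ : c * (1 + 2 * μ) = γ := by rw [hc]; field_simp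
  refine ⟨c ^ 2 / 4, by positivity, fun u hu h => ?_⟩
  have h0 := mul_nonneg hγ.le hu
  unfold energy at h
  have h1 : |u 1| < c := abs_lt_of_sq_lt_sq (by
    nlinarith [sq_nonneg (u 1), sq_nonneg (u 3), sq_nonneg (stretch γ u)]) hc0.le
  have h3 : |u 3| < c := abs_lt_of_sq_lt_sq (by
    nlinarith [sq_nonneg (u 1), sq_nonneg (u 3), sq_nonneg (stretch γ u)]) hc0.le
  have h2 : |stretch γ u| < c := abs_lt_of_sq_lt_sq (by
    nlinarith [sq_nonneg (u 1), sq_nonneg (u 3), sq_nonneg (stretch γ u)]) hc0.le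
  rw [abs_lt] at h1 h2 h3
  unfold accel
  nlinarith [mul_pos hμ (show 0 < c - u 3 by linarith), mul_pos hμ (show 0 < c + u 1 by linarith),
    mul_pos hμ hc0]

/-- The velocity decreases strictly along the flight. If it were zero at landing, it would be
positive before, and the height would rise all the way to its final value zero. -/
theorem exists_chain_of_energy_lt {γ μ δ : ℝ} (hγ : 0 < γ) (hμ : 0 < μ)
    (hδ : ∀ u : State, 0 ≤ u 0 → energy γ u < δ → accel γ μ u < 0) {u : State}
    (h0 : 0 ≤ u 0) (ha : u ∈ airborne) (hE : energy γ u < δ) :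
    ∃ τ, IsFlight γ μ u τ ∧ energy γ (reflect (flow γ μ τ u)) < δ := by
  obtain ⟨τ, hτ, hmem, hfl, hdown⟩ := exists_return hγ hμ h0 ha
  have hEs : ∀ s, 0 ≤ s → energy γ (flow γ μ s u) < δ := fun s hs => by
    have := energy_flow_antitone (γ := γ) hμ u hs
    simp only [flow_zero] at this
    linarith
  refine ⟨τ, ⟨hτ, hmem, hfl, lt_of_le_of_ne hdown fun h1 => ?_⟩, ?_⟩
  · have hnn := flow_height_nonneg h0 hmem
    have hanti : StrictAntiOn (fun s => flow γ μ s u 1) (Icc 0 τ) := by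
      refine strictAntiOn_of_hasDerivWithinAt_neg (convex_Icc 0 τ)
        (continuous_flow_coord γ μ u 1).continuousOn
        (fun s _ => hasDerivWithinAt_velocity (flow_hasDerivWithinAt γ μ s u _)) fun s hs => ?_
      rw [interior_Icc] at hs
      exact hδ _ (hnn s ⟨hs.1.le, hs.2.le⟩) (hEs s hs.1.le)
    have hmono : StrictMonoOn (fun s => flow γ μ s u 0) (Icc 0 τ) := by
      refine strictMonoOn_of_hasDerivWithinAt_pos (convex_Icc 0 τ)
        (continuous_flow_coord γ μ u 0).continuousOn
        (fun s _ => hasDerivWithinAt_height (flow_hasDerivWithinAt γ μ s u _)) fun s hs => ?_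
      rw [interior_Icc] at hs
      have := hanti ⟨hs.1.le, hs.2.le⟩ ⟨hτ.le, le_rfl⟩ hs.2
      simp only [h1] at this
      exact this
    have := hmono ⟨le_rfl, hτ.le⟩ ⟨hτ.le, le_rfl⟩ hτ
    simp only [flow_zero, hfl] at this
    linarith
  · rw [energy_reflect]
    exact hEs τ hτ.le

/-! ### The motion along a chain -/

theorem le_of_right_deriv_nonneg {f f' : ℝ → ℝ} {a b : ℝ} (hab : a ≤ b)
    (hc : ContinuousOn f (Icc a b)) (hd : ∀ t ∈ Ico a b, HasDerivWithinAt f (f' t) (Ici t) t)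
    (h0 : ∀ t ∈ Ico a b, 0 ≤ f' t) : f a ≤ f b :=
  image_le_of_deriv_right_le_deriv_boundary (f := fun _ => f a) (f' := fun _ => 0) continuousOn_const
    (fun t _ => hasDerivWithinAt_const t _ _) le_rfl hc hd h0 ⟨hab, le_rfl⟩

theorem le_of_right_deriv_nonpos {f f' : ℝ → ℝ} {a b : ℝ} (hab : a ≤ b)
    (hc : ContinuousOn f (Icc a b)) (hd : ∀ t ∈ Ico a b, HasDerivWithinAt f (f' t) (Ici t) t)
    (h0 : ∀ t ∈ Ico a b, f' t ≤ 0) : f b ≤ f a := by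
  have := le_of_right_deriv_nonneg hab hc.neg (fun t ht => (hd t ht).neg)
    (fun t ht => neg_nonneg.2 (h0 t ht))
  simpa using this

/-- The time at which the `n`-th flight begins. -/
def startTime (τ : ℕ → ℝ) (n : ℕ) : ℝ := ∑ i ∈ Finset.range n, τ i

theorem startTime_zero (τ : ℕ → ℝ) : startTime τ 0 = 0 := by simp [startTime]

theorem startTime_succ (τ : ℕ → ℝ) (n : ℕ) : startTime τ (n + 1) = startTime τ n + τ n := by
  simp [startTime, Finset.sum_range_succ]

/-- The motion consisting of a sequence of flights. -/
noncomputable def traj (γ μ : ℝ) (u : ℕ → State) (τ : ℕ → ℝ) (t : ℝ) : State :=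
  flow γ μ (t - startTime τ (sSup {n | startTime τ n ≤ t})) (u (sSup {n | startTime τ n ≤ t}))

namespace IsChain

variable {γ μ : ℝ} {u : ℕ → State} {τ : ℕ → ℝ} (C : IsChain γ μ u τ)

include C

theorem strictMono_startTime : StrictMono (startTime τ) :=
  strictMono_nat_of_lt_succ fun n => by
    rw [startTime_succ]
    linarith [(C.flight n).pos]

theorem startTime_nonneg (n : ℕ) : 0 ≤ startTime τ n := by
  rw [← startTime_zero τ]
  exact C.strictMono_startTime.monotone (Nat.zero_le n)

theorem succ_floor (n : ℕ) : u (n + 1) 0 = 0 := by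
  rw [C.next, reflect_zero, (C.flight n).floor]

theorem succ_velocity_pos (n : ℕ) : 0 < u (n + 1) 1 := by
  rw [C.next, reflect_one]
  linarith [(C.flight n).down]

theorem height_nonneg (n : ℕ) : 0 ≤ u n 0 := by
  cases n with
  | zero => exact C.nonneg
  | succ n => exact (C.succ_floor n).ge

theorem traj_eq {n : ℕ} {t : ℝ} (ht : t ∈ Ico (startTime τ n) (startTime τ (n + 1))) :
    traj γ μ u τ t = flow γ μ (t - startTime τ n) (u n) := by
  have h : IsGreatest {n | startTime τ n ≤ t} n := by
    refine ⟨ht.1, fun m hm => ?_⟩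
    have : startTime τ m < startTime τ (n + 1) := lt_of_le_of_lt hm ht.2
    exact Nat.lt_succ_iff.1 (C.strictMono_startTime.lt_iff_lt.1 this)
  rw [traj, h.csSup_eq]

theorem mem_start (n : ℕ) : startTime τ n ∈ Ico (startTime τ n) (startTime τ (n + 1)) :=
  ⟨le_rfl, C.strictMono_startTime n.lt_succ_self⟩

theorem traj_startTime (n : ℕ) : traj γ μ u τ (startTime τ n) = u n := by
  rw [C.traj_eq (C.mem_start n), sub_self, flow_zero]

omit C in
theorem exists_index (τ : ℕ → ℝ) {t : ℝ} (h0 : 0 ≤ t) {N : ℕ} (hN : t < startTime τ N) :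
    ∃ n < N, t ∈ Ico (startTime τ n) (startTime τ (n + 1)) := by
  induction N with
  | zero => rw [startTime_zero] at hN; linarith
  | succ N ih =>
    by_cases h : t < startTime τ N
    · obtain ⟨n, hn, h⟩ := ih h
      exact ⟨n, hn.trans N.lt_succ_self, h⟩
    · exact ⟨N, N.lt_succ_self, not_lt.1 h, hN⟩

theorem traj_hasDerivWithinAt {t : ℝ} (h0 : 0 ≤ t) {N : ℕ} (hN : t < startTime τ N) :
    HasDerivWithinAt (traj γ μ u τ) (freeField γ μ (traj γ μ u τ t)) (Ici t) t := by
  obtain ⟨n, -, hn⟩ := exists_index τ h0 hN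
  rw [C.traj_eq hn]
  have h := ((hasDerivAt_flow γ μ (t - startTime τ n) (u n)).comp_sub_const t
    (startTime τ n)).hasDerivWithinAt (s := Ici t)
  refine h.congr_of_eventuallyEq ?_ (C.traj_eq hn)
  filter_upwards [Ico_mem_nhdsGE hn.2] with s hs
  exact C.traj_eq ⟨hn.1.trans hs.1, hs.2⟩

theorem traj_height_nonneg {t : ℝ} (h0 : 0 ≤ t) {N : ℕ} (hN : t < startTime τ N) :
    0 ≤ traj γ μ u τ t 0 := by
  obtain ⟨n, -, hn⟩ := exists_index τ h0 hN
  rw [C.traj_eq hn]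
  refine flow_height_nonneg (C.height_nonneg n) (C.flight n).mem _ ⟨by linarith [hn.1], ?_⟩
  have := hn.2
  rw [startTime_succ] at this
  linarith

/-- A quantity blind to the reflection does not jump at the closing contact, so the flight formula
extends to the closed interval. Hence such quantities are continuous across contacts and comparison
by right derivatives applies to them. -/
theorem traj_observable_eq {f : State → ℝ} (hf : ∀ v : State, v 0 = 0 → f (reflect v) = f v)
    {n : ℕ} {t : ℝ} (ht : t ∈ Icc (startTime τ n) (startTime τ (n + 1))) :
    f (traj γ μ u τ t) = f (flow γ μ (t - startTime τ n) (u n)) := by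
  rcases ht.2.lt_or_eq with h | h
  · rw [C.traj_eq ⟨ht.1, h⟩]
  · rw [h, C.traj_startTime, C.next, hf _ (C.flight n).floor, startTime_succ, add_sub_cancel_left]

theorem continuousOn_observable {f : State → ℝ} (hc : Continuous f)
    (hf : ∀ v : State, v 0 = 0 → f (reflect v) = f v) (N : ℕ) :
    ContinuousOn (fun t => f (traj γ μ u τ t)) (Icc 0 (startTime τ N)) := by
  induction N with
  | zero => rw [startTime_zero, Icc_self]; exact continuousOn_singleton _ _
  | succ N ih =>
    rw [← Icc_union_Icc_eq_Icc (C.startTime_nonneg N) (C.mem_start N).2.le]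
    refine ih.union_of_isClosed ?_ isClosed_Icc isClosed_Icc
    refine ContinuousOn.congr (f := fun t => f (flow γ μ (t - startTime τ N) (u N))) ?_
      fun t ht => C.traj_observable_eq hf ht
    exact (hc.comp ((continuous_flow_time γ μ (u N)).comp
      (continuous_id.sub continuous_const))).continuousOn

theorem continuousOn_height (N : ℕ) :
    ContinuousOn (fun t => traj γ μ u τ t 0) (Icc 0 (startTime τ N)) :=
  C.continuousOn_observable (f := fun v => v 0) (continuous_apply 0) (fun _ _ => rfl) N

theorem continuousOn_upper_velocity (N : ℕ) :
    ContinuousOn (fun t => traj γ μ u τ t 3) (Icc 0 (startTime τ N)) :=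
  C.continuousOn_observable (f := fun v => v 3) (continuous_apply 3) (fun _ _ => rfl) N

theorem continuousOn_stretch (N : ℕ) :
    ContinuousOn (fun t => stretch γ (traj γ μ u τ t)) (Icc 0 (startTime τ N)) :=
  C.continuousOn_observable (continuous_stretch γ) (fun _ _ => stretch_reflect γ _) N

theorem continuousOn_energy (N : ℕ) :
    ContinuousOn (fun t => energy γ (traj γ μ u τ t)) (Icc 0 (startTime τ N)) :=
  C.continuousOn_observable (continuous_energy γ) (fun _ _ => energy_reflect γ _) N

theorem continuousOn_velocity_sq (N : ℕ) :
    ContinuousOn (fun t => traj γ μ u τ t 1 ^ 2) (Icc 0 (startTime τ N)) :=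
  C.continuousOn_observable (f := fun v => v 1 ^ 2) ((continuous_apply 1).pow 2)
    (fun v _ => by simp) N

theorem energy_antitone (hμ : 0 < μ) {s t : ℝ} (h0 : 0 ≤ s) (hst : s ≤ t) {N : ℕ}
    (hN : t ≤ startTime τ N) : energy γ (traj γ μ u τ t) ≤ energy γ (traj γ μ u τ s) := by
  refine le_of_right_deriv_nonpos hst
    ((C.continuousOn_energy N).mono (Icc_subset_Icc h0 hN))
    (fun r hr => hasDerivWithinAt_energy
      (C.traj_hasDerivWithinAt (h0.trans hr.1) (hr.2.trans_le hN))) fun r _ => ?_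
  nlinarith [mul_nonneg hμ.le (sq_nonneg (traj γ μ u τ r 3 - traj γ μ u τ r 1))]

end IsChain

/-! ### Contacts do not accumulate -/

/-- The force with which the lower mass would be pressed on the floor, if it rested on it. -/
noncomputable def pressure (γ μ : ℝ) (u : State) : ℝ := 2 * γ - stretch γ u / 2 - μ * u 3

/-- The time derivative of the pressure. -/
noncomputable def pressureRate (γ μ : ℝ) (u : State) : ℝ :=
  (μ ^ 2 - 1 / 2) * (u 3 - u 1) + μ * stretch γ u / 2

theorem accel_eq (γ μ : ℝ) (u : State) : accel γ μ u = -pressure γ μ u - μ * u 1 := by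
  simp only [accel, pressure]; ring

theorem hasDerivWithinAt_pressure {γ μ t : ℝ} {f : ℝ → State} {S : Set ℝ}
    (h : HasDerivWithinAt f (freeField γ μ (f t)) S t) :
    HasDerivWithinAt (fun s => pressure γ μ (f s)) (pressureRate γ μ (f t)) S t := by
  refine ((((hasDerivWithinAt_stretch h).div_const 2).const_sub (2 * γ)).sub
    ((hasDerivWithinAt_upper_velocity h).const_mul μ)).congr_deriv ?_
  simp only [pressureRate]; ring

theorem le_limit_of_right_deriv_nonneg {f f' : ℝ → ℝ} {a T l : ℝ}
    (hc : ∀ b < T, ContinuousOn f (Icc a b))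
    (hd : ∀ t ∈ Ico a T, HasDerivWithinAt f (f' t) (Ici t) t) (h0 : ∀ t ∈ Ico a T, 0 ≤ f' t)
    (hl : Tendsto f (𝓝[<] T) (𝓝 l)) {t : ℝ} (ht : t ∈ Ico a T) : f t ≤ l := by
  refine ge_of_tendsto hl ?_
  filter_upwards [Ico_mem_nhdsLT ht.2] with s hs
  exact le_of_right_deriv_nonneg hs.1 ((hc s hs.2).mono (Icc_subset_Icc_left ht.1))
    (fun r hr => hd r ⟨ht.1.trans hr.1, hr.2.trans hs.2⟩)
    (fun r hr => h0 r ⟨ht.1.trans hr.1, hr.2.trans hs.2⟩)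

theorem exists_limit_of_right_deriv_bounded {f f' : ℝ → ℝ} {a T K : ℝ}
    (hc : ∀ b < T, ContinuousOn f (Icc a b)) (haT : a < T)
    (hd : ∀ t ∈ Ico a T, HasDerivWithinAt f (f' t) (Ici t) t) (hK : ∀ t ∈ Ico a T, |f' t| ≤ K) :
    ∃ l, Tendsto f (𝓝[<] T) (𝓝 l) := by
  have hK0 : 0 ≤ K := (abs_nonneg _).trans (hK a ⟨le_rfl, haT⟩)
  have key : ∀ s ∈ Ico a T, ∀ t ∈ Ico a T, s ≤ t → |f s - f t| ≤ K * (t - s) := by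
    intro s hs t ht hst
    have hsub : Icc s t ⊆ Icc a t := Icc_subset_Icc_left hs.1
    have hm : ∀ r ∈ Ico s t, r ∈ Ico a T := fun r hr => ⟨hs.1.trans hr.1, hr.2.trans ht.2⟩
    have h1 := le_of_right_deriv_nonneg (f := fun r => f r + K * r) (f' := fun r => f' r + K * 1) hst
      (((hc t ht.2).mono hsub).add (by fun_prop))
      (fun r hr => (hd r (hm r hr)).add ((hasDerivWithinAt_id r _).const_mul K))
      (fun r hr => by have := (abs_le.1 (hK r (hm r hr))).1; linarith)
    have h2 := le_of_right_deriv_nonpos (f := fun r => f r - K * r) (f' := fun r => f' r - K * 1) hst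
      (((hc t ht.2).mono hsub).sub (by fun_prop))
      (fun r hr => (hd r (hm r hr)).sub ((hasDerivWithinAt_id r _).const_mul K))
      (fun r hr => by have := (abs_le.1 (hK r (hm r hr))).2; linarith)
    rw [abs_le]; constructor <;> linarith
  have hL : LipschitzOnWith K.toNNReal f (Ico a T) := by
    refine LipschitzOnWith.of_dist_le_mul fun s hs t ht => ?_
    rw [Real.coe_toNNReal K hK0, Real.dist_eq, Real.dist_eq]
    rcases le_total s t with h | h
    · rw [abs_sub_comm s t, abs_of_nonneg (sub_nonneg.2 h)]
      exact key s hs t ht h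
    · rw [abs_sub_comm (f s), abs_of_nonneg (sub_nonneg.2 h)]
      exact key t ht s hs h
  obtain ⟨g, hg, hfg⟩ := hL.extend_real
  refine ⟨g T, ((hg.continuous.tendsto T).mono_left nhdsWithin_le_nhds).congr' ?_⟩
  filter_upwards [Ico_mem_nhdsLT haT] with s hs
  exact (hfg hs).symm

theorem coord_bounds {γ : ℝ} (hγ : 0 < γ) {v : State} (hv : 0 ≤ v 0) :
    |v 1| ≤ energy γ v + 1 ∧ |v 3| ≤ energy γ v + 1 ∧ |stretch γ v| ≤ energy γ v + 1 := by
  refine ⟨?_, ?_, abs_stretch_le hγ hv⟩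
  all_goals
    have h := mul_nonneg hγ.le hv
    rw [abs_le]; unfold energy
    constructor <;> nlinarith [sq_nonneg (v 1), sq_nonneg (v 3), sq_nonneg (stretch γ v),
      sq_nonneg (v 1 - 1), sq_nonneg (v 1 + 1), sq_nonneg (v 3 - 1), sq_nonneg (v 3 + 1)]

namespace IsChain

variable {γ μ : ℝ} {u : ℕ → State} {τ : ℕ → ℝ} (C : IsChain γ μ u τ)

include C

theorem traj_bounds (hγ : 0 < γ) (hμ : 0 < μ) {t : ℝ} (h0 : 0 ≤ t) {N : ℕ}
    (hN : t < startTime τ N) :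
    |traj γ μ u τ t 1| ≤ energy γ (u 0) + 1 ∧ |traj γ μ u τ t 3| ≤ energy γ (u 0) + 1 ∧
      |stretch γ (traj γ μ u τ t)| ≤ energy γ (u 0) + 1 := by
  obtain ⟨h1, h3, h2⟩ := coord_bounds hγ (C.traj_height_nonneg h0 hN)
  have hE := C.energy_antitone hμ le_rfl h0 hN.le
  have h00 : traj γ μ u τ 0 = u 0 := by
    have := C.traj_startTime 0
    rwa [startTime_zero] at this
  rw [h00] at hE
  exact ⟨by linarith, by linarith, by linarith⟩

theorem continuousOn_pressure (N : ℕ) :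
    ContinuousOn (fun t => pressure γ μ (traj γ μ u τ t)) (Icc 0 (startTime τ N)) :=
  (continuousOn_const.sub ((C.continuousOn_stretch N).div_const 2)).sub
    (continuousOn_const.mul (C.continuousOn_upper_velocity N))

/-- Since `v' = -p - μ v`, nonpositive pressure would make `exp (μ s) * v` nondecreasing on the
flight, but `v` is positive at takeoff and negative at landing. -/
theorem exists_pressure_pos (n : ℕ) :
    ∃ t ∈ Ico (startTime τ (n + 1)) (startTime τ (n + 2)), 0 < pressure γ μ (traj γ μ u τ t) := by
  by_contra! hcon
  have hτ := (C.flight (n + 1)).pos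
  have h := le_of_right_deriv_nonneg
    (f := fun s => Real.exp (μ * s) * flow γ μ s (u (n + 1)) 1)
    (f' := fun s => Real.exp (μ * s) * (-pressure γ μ (flow γ μ s (u (n + 1)))))
    hτ.le ((Continuous.mul (by fun_prop) (continuous_flow_coord γ μ _ 1)).continuousOn)
    (fun s _ => by
      have h1 : HasDerivWithinAt (fun s => Real.exp (μ * s)) (Real.exp (μ * s) * (μ * 1)) (Ici s) s :=
        (((hasDerivAt_id s).const_mul μ).exp).hasDerivWithinAt
      refine (h1.mul (hasDerivWithinAt_velocity
        (flow_hasDerivWithinAt γ μ s (u (n + 1)) _))).congr_deriv ?_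
      rw [accel_eq]; ring)
    (fun s hs => by
      refine mul_nonneg (Real.exp_pos _).le (neg_nonneg.2 ?_)
      have hm : startTime τ (n + 1) + s ∈ Ico (startTime τ (n + 1)) (startTime τ (n + 2)) := by
        rw [startTime_succ τ (n + 1)]
        exact ⟨by linarith [hs.1], by linarith [hs.2]⟩
      have := hcon _ hm
      rwa [C.traj_eq hm, add_sub_cancel_left] at this)
  simp only [mul_zero, Real.exp_zero, flow_zero, one_mul] at h
  have h1 := C.succ_velocity_pos n
  have h2 := mul_neg_of_pos_of_neg (Real.exp_pos (μ * τ (n + 1))) (C.flight (n + 1)).down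
  linarith

variable {T : ℝ} (hT : Tendsto (startTime τ) atTop (𝓝 T))

include hT

theorem startTime_lt (n : ℕ) : startTime τ n < T :=
  (C.strictMono_startTime n.lt_succ_self).trans_le
    (C.strictMono_startTime.monotone.ge_of_tendsto hT (n + 1))

omit C in
theorem exists_lt_startTime {t : ℝ} (ht : t < T) : ∃ N, t < startTime τ N :=
  (hT.eventually (lt_mem_nhds ht)).exists

omit C in
theorem exists_tail {P : ℝ → Prop} (h : ∀ᶠ t in 𝓝[<] T, P t) :
    ∃ N, ∀ t ∈ Ico (startTime τ (N + 1)) T, P t := by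
  obtain ⟨a, ha, hP⟩ := (mem_nhdsLT_iff_exists_Ioo_subset).1 h
  obtain ⟨N, hN⟩ := ((tendsto_add_atTop_iff_nat 1).2 hT |>.eventually (lt_mem_nhds ha)).exists
  exact ⟨N, fun t ht => hP ⟨hN.trans_le ht.1, ht.2⟩⟩

theorem tail_hasDerivWithinAt {n : ℕ} : ∀ t ∈ Ico (startTime τ n) T,
    HasDerivWithinAt (traj γ μ u τ) (freeField γ μ (traj γ μ u τ t)) (Ici t) t := by
  intro t ht
  obtain ⟨N, hN⟩ := exists_lt_startTime hT ht.2
  exact C.traj_hasDerivWithinAt ((C.startTime_nonneg n).trans ht.1) hN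

theorem tail_continuousOn {f : ℝ → ℝ} (hf : ∀ N, ContinuousOn f (Icc 0 (startTime τ N))) {n : ℕ} :
    ∀ b < T, ContinuousOn f (Icc (startTime τ n) b) := by
  intro b hb
  obtain ⟨N, hN⟩ := exists_lt_startTime hT hb
  exact (hf N).mono (Icc_subset_Icc (C.startTime_nonneg n) hN.le)

/-- If the acceleration is small until the limit of the times of contact, then so is the velocity. -/
theorem abs_velocity_le {K : ℝ} {N : ℕ}
    (hK : ∀ t ∈ Ico (startTime τ N) T, |accel γ μ (traj γ μ u τ t)| ≤ K) :
    ∀ t ∈ Ico (startTime τ N) T, |traj γ μ u τ t 1| ≤ K * (T - t) := by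
  have key : ∀ n ≥ N, ∀ r ∈ Icc 0 (τ n),
      |flow γ μ (τ n) (u n) 1 - flow γ μ r (u n) 1| ≤ K * (τ n - r) := by
    intro n hn r hr
    have ha : ∀ s ∈ Ico r (τ n), |accel γ μ (flow γ μ s (u n))| ≤ K := by
      intro s hs
      have hm : startTime τ n + s ∈ Ico (startTime τ n) (startTime τ (n + 1)) := by
        rw [startTime_succ]
        exact ⟨by linarith [hs.1, hr.1], by linarith [hs.2]⟩
      have := hK _ ⟨(C.strictMono_startTime.monotone hn).trans hm.1,
        hm.2.trans (C.startTime_lt hT _)⟩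
      rwa [C.traj_eq hm, add_sub_cancel_left] at this
    have hd : ∀ s ∈ Ico r (τ n), HasDerivWithinAt (fun s => flow γ μ s (u n) 1)
        (accel γ μ (flow γ μ s (u n))) (Ici s) s := fun s _ =>
      hasDerivWithinAt_velocity (flow_hasDerivWithinAt γ μ s (u n) _)
    have hc := (continuous_flow_coord γ μ (u n) 1).continuousOn (s := Icc r (τ n))
    have h1 := le_of_right_deriv_nonneg hr.2 (hc.add (continuousOn_const.mul continuousOn_id))
      (fun s hs => (hd s hs).add ((hasDerivWithinAt_id s _).const_mul K))
      (fun s hs => by have := (abs_le.1 (ha s hs)).1; linarith)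
    have h2 := le_of_right_deriv_nonpos hr.2 (hc.sub (continuousOn_const.mul continuousOn_id))
      (fun s hs => (hd s hs).sub ((hasDerivWithinAt_id s _).const_mul K))
      (fun s hs => by have := (abs_le.1 (ha s hs)).2; linarith)
    simp only [Pi.add_apply, Pi.sub_apply, Pi.mul_apply, id] at h1 h2
    rw [abs_le]; constructor <;> linarith
  intro t ht
  obtain ⟨N', hN'⟩ := exists_lt_startTime hT ht.2
  obtain ⟨n, -, hn⟩ := exists_index τ ((C.startTime_nonneg N).trans ht.1) hN'
  have hnN : N ≤ n := Nat.lt_succ_iff.1 (C.strictMono_startTime.lt_iff_lt.1 (ht.1.trans_lt hn.2))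
  have hs1 := startTime_succ τ n
  have hs2 := startTime_succ τ (n + 1)
  have h1 := abs_le.1 (key n hnN (t - startTime τ n) ⟨by linarith [hn.1], by linarith [hn.2]⟩)
  -- The next flight leaves upwards and lands downwards, so its takeoff speed is at most `K * τ (n +
  -- 1)`. This is also the landing speed of the current flight.
  have h2 := abs_le.1 (key (n + 1) (by omega) 0 ⟨le_rfl, (C.flight (n + 1)).pos.le⟩)
  have h3 := C.succ_velocity_pos n
  have h4 : u (n + 1) 1 = -flow γ μ (τ n) (u n) 1 := by rw [C.next, reflect_one]
  have h5 := (C.flight (n + 1)).down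
  have h6 := C.startTime_lt hT (n + 1 + 1)
  have hK0 : 0 ≤ K := (abs_nonneg _).trans (hK t ht)
  have h7 : K * (startTime τ (n + 1 + 1) - t) ≤ K * (T - t) :=
    mul_le_mul_of_nonneg_left (by linarith) hK0
  rw [flow_zero] at h2
  rw [C.traj_eq hn]
  have h8 : K * (startTime τ (n + 1 + 1) - t) =
    K * (τ n - (t - startTime τ n)) + K * (τ (n + 1) - 0) := by rw [hs2, hs1]; ring
  rw [abs_le]; constructor <;> linarith

omit C in
theorem tendsto_duration : Tendsto τ atTop (𝓝 0) := by
  have h := ((tendsto_add_atTop_iff_nat 1).2 hT).sub hT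
  rw [sub_self] at h
  refine h.congr fun n => ?_
  rw [startTime_succ, add_sub_cancel_left]

theorem pressure_growth {c : ℝ} {N : ℕ}
    (hr : ∀ t ∈ Ico (startTime τ (N + 1)) T,
      pressureRate γ μ (traj γ μ u τ t) ≤ c * pressure γ μ (traj γ μ u τ t)) {s t : ℝ}
    (hs : startTime τ (N + 1) ≤ s) (hst : s ≤ t) (ht : t < T) :
    pressure γ μ (traj γ μ u τ t) ≤ pressure γ μ (traj γ μ u τ s) * Real.exp (c * (t - s)) := by
  have h := le_of_right_deriv_nonpos
    (f := fun t => Real.exp (-(c * t)) * pressure γ μ (traj γ μ u τ t))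
    (f' := fun t => Real.exp (-(c * t)) *
      (pressureRate γ μ (traj γ μ u τ t) - c * pressure γ μ (traj γ μ u τ t))) hst
    ((by fun_prop : Continuous fun t => Real.exp (-(c * t))).continuousOn.mul
      ((C.tail_continuousOn hT C.continuousOn_pressure t ht).mono (Icc_subset_Icc_left hs)))
    (fun r hr => by
      have h1 : HasDerivWithinAt (fun s => Real.exp (-(c * s)))
          (Real.exp (-(c * r)) * (-(c * 1))) (Ici r) r :=
        (((hasDerivAt_id r).const_mul c).neg.exp).hasDerivWithinAt
      refine (h1.mul (hasDerivWithinAt_pressure (C.tail_hasDerivWithinAt hT r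
        ⟨hs.trans hr.1, hr.2.trans ht⟩))).congr_deriv ?_
      ring)
    (fun r hr' => mul_nonpos_of_nonneg_of_nonpos (Real.exp_pos _).le
      (by linarith [hr r ⟨hs.trans hr'.1, hr'.2.trans ht⟩]))
  have h2 := mul_le_mul_of_nonneg_left h (Real.exp_pos (c * t)).le
  rw [← mul_assoc, ← mul_assoc, ← Real.exp_add, ← Real.exp_add, add_neg_cancel, Real.exp_zero,
    one_mul] at h2
  rw [mul_comm, mul_sub, sub_eq_add_neg]
  exact h2

/-- Within the flight the pressure must reverse the takeoff velocity, and by `pressure_growth` it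
exceeds its takeoff value at most by an exponential factor. -/
theorem velocity_le_mul_pressure {c : ℝ} (hc : 0 ≤ c) (hμ : 0 < μ) {N : ℕ}
    (hp : ∀ t ∈ Ico (startTime τ (N + 1)) T, 0 < pressure γ μ (traj γ μ u τ t))
    (hr : ∀ t ∈ Ico (startTime τ (N + 1)) T,
      pressureRate γ μ (traj γ μ u τ t) ≤ c * pressure γ μ (traj γ μ u τ t)) {n : ℕ}
    (hn : N ≤ n) :
    u (n + 1) 1 ≤ Real.exp ((μ + c) * T) * pressure γ μ (u (n + 1)) * τ (n + 1) := by
  have hpn : 0 < pressure γ μ (u (n + 1)) := by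
    rw [← C.traj_startTime (n + 1)]
    exact hp _ ⟨C.strictMono_startTime.monotone (by omega), C.startTime_lt hT _⟩
  have h := le_of_right_deriv_nonneg
    (f := fun s => Real.exp (μ * s) * flow γ μ s (u (n + 1)) 1 +
      Real.exp ((μ + c) * T) * pressure γ μ (u (n + 1)) * s)
    (f' := fun s => Real.exp (μ * s) * (-pressure γ μ (flow γ μ s (u (n + 1)))) +
      Real.exp ((μ + c) * T) * pressure γ μ (u (n + 1)) * 1)
    (C.flight (n + 1)).pos.le
    (((Continuous.mul (by fun_prop) (continuous_flow_coord γ μ _ 1)).add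
      (by fun_prop)).continuousOn)
    (fun s _ => by
      have h1 : HasDerivWithinAt (fun s => Real.exp (μ * s)) (Real.exp (μ * s) * (μ * 1)) (Ici s) s :=
        (((hasDerivAt_id s).const_mul μ).exp).hasDerivWithinAt
      refine ((h1.mul (hasDerivWithinAt_velocity
        (flow_hasDerivWithinAt γ μ s (u (n + 1)) _))).add
        ((hasDerivWithinAt_id s _).const_mul _)).congr_deriv ?_
      rw [accel_eq]; ring)
    (fun s hs => by
      have hm : startTime τ (n + 1) + s ∈ Ico (startTime τ (n + 1)) (startTime τ (n + 2)) := by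
        rw [startTime_succ τ (n + 1)]
        exact ⟨by linarith [hs.1], by linarith [hs.2]⟩
      have hsT : startTime τ (n + 1) + s < T := hm.2.trans (C.startTime_lt hT _)
      have hsT' : s ≤ T := by linarith [C.startTime_nonneg (n + 1)]
      have h1 := C.pressure_growth hT hr (C.strictMono_startTime.monotone (by omega)) hm.1 hsT
      rw [C.traj_eq hm, add_sub_cancel_left, C.traj_startTime] at h1
      have h2 : Real.exp (μ * s) * pressure γ μ (flow γ μ s (u (n + 1))) ≤
          Real.exp (μ * s) * (pressure γ μ (u (n + 1)) * Real.exp (c * s)) :=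
        mul_le_mul_of_nonneg_left h1 (Real.exp_pos _).le
      have h3 : Real.exp (μ * s) * Real.exp (c * s) ≤ Real.exp ((μ + c) * T) := by
        rw [← Real.exp_add, ← add_mul]
        exact Real.exp_le_exp.2 (mul_le_mul_of_nonneg_left hsT' (by linarith))
      have h4 := mul_le_mul_of_nonneg_right h3 hpn.le
      linarith)
  simp only [mul_zero, Real.exp_zero, flow_zero, one_mul, add_zero] at h
  have h2 := mul_neg_of_pos_of_neg (Real.exp_pos (μ * τ (n + 1))) (C.flight (n + 1)).down
  linarith

/-- Let `Z = x + v² / (2p)`, the apex height under constant pressure `p`. It is continuous through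
contacts, and `exp (k t) * Z` is nondecreasing for `k = 2 * μ + c`, so `Z` stays away from zero. But
at contacts `Z` is at most a constant times the squared duration of the next flight, which tends to
zero. -/
theorem false_of_pressure_pos (hγ : 0 < γ) (hμ : 0 < μ) {c : ℝ} (hc : 0 ≤ c) {N : ℕ}
    (hp : ∀ t ∈ Ico (startTime τ (N + 1)) T, 0 < pressure γ μ (traj γ μ u τ t))
    (hr : ∀ t ∈ Ico (startTime τ (N + 1)) T,
      pressureRate γ μ (traj γ μ u τ t) ≤ c * pressure γ μ (traj γ μ u τ t)) : False := by
  set Z : ℝ → ℝ := fun t => traj γ μ u τ t 0 +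
    traj γ μ u τ t 1 ^ 2 / (2 * pressure γ μ (traj γ μ u τ t)) with hZ
  set k := 2 * μ + c with hk
  have hmono : ∀ n ≥ N, Real.exp (k * startTime τ (N + 1)) * Z (startTime τ (N + 1)) ≤
      Real.exp (k * startTime τ (n + 1)) * Z (startTime τ (n + 1)) := by
    intro n hn
    have hnT := C.startTime_lt hT (n + 1)
    refine le_of_right_deriv_nonneg
      (f := fun t => Real.exp (k * t) * Z t)
      (f' := fun t => Real.exp (k * t) * (k * traj γ μ u τ t 0 +
        traj γ μ u τ t 1 ^ 2 / (2 * pressure γ μ (traj γ μ u τ t) ^ 2) *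
        (c * pressure γ μ (traj γ μ u τ t) - pressureRate γ μ (traj γ μ u τ t))))
      (C.strictMono_startTime.monotone (by omega)) ?_ ?_ ?_
    · refine (by fun_prop : Continuous fun t => Real.exp (k * t)).continuousOn.mul ?_
      refine (C.tail_continuousOn hT C.continuousOn_height _ hnT).add
        ((C.tail_continuousOn hT C.continuousOn_velocity_sq _ hnT).div
        (continuousOn_const.mul (C.tail_continuousOn hT C.continuousOn_pressure _ hnT)) ?_)
      intro t ht
      have := hp t ⟨ht.1, ht.2.trans_lt hnT⟩
      positivity
    · intro t ht
      have htT : t ∈ Ico (startTime τ (N + 1)) T := ⟨ht.1, ht.2.trans hnT⟩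
      have hpt := hp t htT
      have hd := C.tail_hasDerivWithinAt hT t htT
      have h1 : HasDerivWithinAt (fun s => Real.exp (k * s)) (Real.exp (k * t) * (k * 1)) (Ici t) t :=
        (((hasDerivAt_id t).const_mul k).exp).hasDerivWithinAt
      refine (h1.mul ((hasDerivWithinAt_height hd).add (((hasDerivWithinAt_velocity hd).pow 2).div
        ((hasDerivWithinAt_pressure hd).const_mul 2) (by positivity)))).congr_deriv ?_
      rw [accel_eq, hk]
      simp only [Pi.add_apply, Pi.div_apply, Pi.pow_apply]
      field_simp
      push_cast
      ring
    · intro t ht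
      have htT : t ∈ Ico (startTime τ (N + 1)) T := ⟨ht.1, ht.2.trans hnT⟩
      have hpt := hp t htT
      have hrt := hr t htT
      have hx : 0 ≤ traj γ μ u τ t 0 :=
        C.traj_height_nonneg ((C.startTime_nonneg _).trans ht.1) ht.2
      have : 0 ≤ c * pressure γ μ (traj γ μ u τ t) - pressureRate γ μ (traj γ μ u τ t) := by
        linarith
      positivity
  have hpn : ∀ n ≥ N, 0 < pressure γ μ (u (n + 1)) := fun n hn => by
    rw [← C.traj_startTime (n + 1)]
    exact hp _ ⟨C.strictMono_startTime.monotone (by omega), C.startTime_lt hT _⟩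
  have hZn : ∀ n, Z (startTime τ (n + 1)) =
      u (n + 1) 1 ^ 2 / (2 * pressure γ μ (u (n + 1))) := by
    intro n
    simp only [hZ, C.traj_startTime, C.succ_floor, zero_add]
  set z := Real.exp (k * startTime τ (N + 1)) * Z (startTime τ (N + 1)) with hz
  have hz0 : 0 < z := by
    have h1 := hpn N le_rfl
    have h2 := C.succ_velocity_pos N
    rw [hz, hZn]
    positivity
  set P := 2 * γ + (energy γ (u 0) + 1) / 2 + μ * (energy γ (u 0) + 1) with hP
  set K := Real.exp ((μ + c) * T) with hK
  have hk0 : 0 ≤ k := by positivity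
  have hupper : ∀ n ≥ N, z ≤ Real.exp (k * T) * (K ^ 2 * P / 2) * τ (n + 1) ^ 2 := by
    intro n hn
    have h1 := C.velocity_le_mul_pressure hT hc hμ hp hr hn
    have h2 := C.succ_velocity_pos n
    have h3 := hpn n hn
    have h4 : pressure γ μ (u (n + 1)) ≤ P := by
      have hb := C.traj_bounds hγ hμ (C.startTime_nonneg (n + 1)) (C.mem_start (n + 1)).2
      rw [C.traj_startTime] at hb
      have hb2 := abs_le.1 hb.2.1
      have hb3 := abs_le.1 hb.2.2
      have := mul_nonneg hμ.le (show 0 ≤ energy γ (u 0) + 1 + u (n + 1) 3 by linarith)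
      simp only [pressure, hP]
      linarith
    have h5 : u (n + 1) 1 ^ 2 ≤ (K * pressure γ μ (u (n + 1)) * τ (n + 1)) ^ 2 :=
      pow_le_pow_left₀ h2.le h1 2
    have h6 : u (n + 1) 1 ^ 2 / (2 * pressure γ μ (u (n + 1))) ≤ K ^ 2 * P / 2 * τ (n + 1) ^ 2 := by
      rw [div_le_iff₀ (by positivity)]
      refine h5.trans ?_
      have h7 : (K * pressure γ μ (u (n + 1)) * τ (n + 1)) ^ 2 =
        (K ^ 2 * τ (n + 1) ^ 2 * pressure γ μ (u (n + 1))) * pressure γ μ (u (n + 1)) := by ring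
      have h8 : K ^ 2 * P / 2 * τ (n + 1) ^ 2 * (2 * pressure γ μ (u (n + 1))) =
        (K ^ 2 * τ (n + 1) ^ 2 * pressure γ μ (u (n + 1))) * P := by ring
      rw [h7, h8]
      exact mul_le_mul_of_nonneg_left h4 (by positivity)
    have h9 : Real.exp (k * startTime τ (n + 1)) ≤ Real.exp (k * T) :=
      Real.exp_le_exp.2 (mul_le_mul_of_nonneg_left (C.startTime_lt hT _).le hk0)
    calc z ≤ _ := hmono n hn
      _ ≤ Real.exp (k * T) * (K ^ 2 * P / 2 * τ (n + 1) ^ 2) := by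
        rw [hZn]
        exact mul_le_mul h9 h6 (by positivity) (Real.exp_pos _).le
      _ = _ := by ring
  have hlim : Tendsto (fun n => Real.exp (k * T) * (K ^ 2 * P / 2) * τ (n + 1) ^ 2) atTop (𝓝 0) := by
    have h := (((tendsto_add_atTop_iff_nat 1).2 (tendsto_duration hT)).pow 2).const_mul
      (Real.exp (k * T) * (K ^ 2 * P / 2))
    simpa using h
  have := ge_of_tendsto hlim (eventually_atTop.2 ⟨N, fun n hn => hupper n hn⟩)
  linarith

/-- Integrating back from `T` gives `p ≥ c / 2 * (T - t) ^ 2 > 0`, and since the rate is nonpositive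
`false_of_pressure_pos` applies with growth constant zero. -/
theorem false_of_pressureRate_neg (hγ : 0 < γ) (hμ : 0 < μ) {c : ℝ} (hc : 0 < c) {N : ℕ}
    (hl : Tendsto (fun t => pressure γ μ (traj γ μ u τ t)) (𝓝[<] T) (𝓝 0))
    (hr : ∀ t ∈ Ico (startTime τ (N + 1)) T,
      pressureRate γ μ (traj γ μ u τ t) ≤ -c * (T - t)) : False := by
  have hpos : ∀ t ∈ Ico (startTime τ (N + 1)) T, 0 < pressure γ μ (traj γ μ u τ t) := by
    intro t ht
    have h := le_limit_of_right_deriv_nonneg (l := 0)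
      (f := fun t => c / 2 * (T - t) ^ 2 - pressure γ μ (traj γ μ u τ t))
      (f' := fun t => -c * (T - t) - pressureRate γ μ (traj γ μ u τ t))
      (fun b hb => (by fun_prop : Continuous fun t => c / 2 * (T - t) ^ 2).continuousOn.sub
        (C.tail_continuousOn hT C.continuousOn_pressure b hb))
      (fun s hs => by
        have h1 : HasDerivWithinAt (fun t => c / 2 * (T - t) ^ 2) (-c * (T - s)) (Ici s) s := by
          refine (((((hasDerivAt_id s).const_sub T).pow 2).const_mul
            (c / 2)).hasDerivWithinAt).congr_deriv ?_
          simp; ring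
        exact h1.sub (hasDerivWithinAt_pressure (C.tail_hasDerivWithinAt hT s hs)))
      (fun s hs => by linarith [hr s hs])
      (by
        have h1 : Tendsto (fun t => c / 2 * (T - t) ^ 2) (𝓝[<] T) (𝓝 (c / 2 * (T - T) ^ 2)) :=
          ((by fun_prop : Continuous fun t => c / 2 * (T - t) ^ 2).tendsto T).mono_left
            nhdsWithin_le_nhds
        simpa using h1.sub hl) ht
    have : 0 < c / 2 * (T - t) ^ 2 := by
      have := sub_pos.2 ht.2
      positivity
    linarith
  refine C.false_of_pressure_pos hT hγ hμ le_rfl hpos fun t ht => (hr t ht).trans ?_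
  have := mul_nonneg hc.le (sub_nonneg.2 ht.2.le)
  linarith

/-- Bounded energy bounds the derivatives of the two continuous quantities, and bounded acceleration
forces the lower velocity to vanish at `T` by `abs_velocity_le`. -/
theorem exists_limits (hγ : 0 < γ) (hμ : 0 < μ) : ∃ d w,
    Tendsto (fun t => stretch γ (traj γ μ u τ t)) (𝓝[<] T) (𝓝 d) ∧
    Tendsto (fun t => traj γ μ u τ t 3) (𝓝[<] T) (𝓝 w) ∧
    Tendsto (fun t => traj γ μ u τ t 1) (𝓝[<] T) (𝓝 0) := by
  set M := energy γ (u 0) + 1 with hM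
  have hb : ∀ t ∈ Ico (startTime τ 0) T, |traj γ μ u τ t 1| ≤ M ∧ |traj γ μ u τ t 3| ≤ M ∧
      |stretch γ (traj γ μ u τ t)| ≤ M := by
    intro t ht
    obtain ⟨N, hN⟩ := exists_lt_startTime hT ht.2
    exact C.traj_bounds hγ hμ ((C.startTime_nonneg 0).trans ht.1) hN
  have hwv : ∀ t ∈ Ico (startTime τ 0) T, |traj γ μ u τ t 3 - traj γ μ u τ t 1| ≤ 2 * M := by
    intro t ht
    obtain ⟨h1, h3, -⟩ := hb t ht
    exact (abs_sub _ _).trans (by linarith)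
  have hμwv : ∀ t ∈ Ico (startTime τ 0) T,
      |μ * (traj γ μ u τ t 3 - traj γ μ u τ t 1)| ≤ μ * (2 * M) := by
    intro t ht
    rw [abs_mul, abs_of_pos hμ]
    exact mul_le_mul_of_nonneg_left (hwv t ht) hμ.le
  obtain ⟨d, hd⟩ := exists_limit_of_right_deriv_bounded (C.tail_continuousOn hT
    C.continuousOn_stretch) (C.startTime_lt hT 0)
    (fun t ht => hasDerivWithinAt_stretch (C.tail_hasDerivWithinAt hT t ht)) hwv
  obtain ⟨w, hw⟩ := exists_limit_of_right_deriv_bounded (K := M / 2 + μ * (2 * M))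
    (C.tail_continuousOn hT C.continuousOn_upper_velocity) (C.startTime_lt hT 0)
    (fun t ht => hasDerivWithinAt_upper_velocity (C.tail_hasDerivWithinAt hT t ht))
    (fun t ht => by
      have h1 := abs_le.1 (hμwv t ht)
      have h2 := abs_le.1 (hb t ht).2.2
      rw [abs_le]; constructor <;> linarith)
  refine ⟨d, w, hd, hw, ?_⟩
  have hv := C.abs_velocity_le hT (K := M / 2 + 2 * γ + μ * (2 * M)) (N := 0) fun t ht => by
      have h1 := abs_le.1 (hμwv t ht)
      have h2 := abs_le.1 (hb t ht).2.2
      unfold accel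
      rw [abs_le]; constructor <;> linarith
  refine squeeze_zero_norm' (a := fun t => (M / 2 + 2 * γ + μ * (2 * M)) * (T - t)) ?_ ?_
  · filter_upwards [Ico_mem_nhdsLT (C.startTime_lt hT 0)] with t ht
    exact hv t ht
  · have h1 : Tendsto (fun t => (M / 2 + 2 * γ + μ * (2 * M)) * (T - t)) (𝓝[<] T)
        (𝓝 ((M / 2 + 2 * γ + μ * (2 * M)) * (T - T))) :=
      ((by fun_prop : Continuous fun t => (M / 2 + 2 * γ + μ * (2 * M)) * (T - t)).tendsto
        T).mono_left nhdsWithin_le_nhds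
    simpa using h1

/-- The contacts with the floor do not accumulate. -/
theorem false_of_tendsto (hγ : 0 < γ) (hμ : 0 < μ) : False := by
  obtain ⟨d, w, hd, hw, hv⟩ := C.exists_limits hT hγ hμ
  have hT0 : 0 < T := (C.startTime_nonneg 0).trans_lt (C.startTime_lt hT 0)
  have hA : Tendsto (fun t => pressure γ μ (traj γ μ u τ t)) (𝓝[<] T)
      (𝓝 (2 * γ - d / 2 - μ * w)) :=
    (tendsto_const_nhds.sub (hd.div_const 2)).sub (hw.const_mul μ)
  have hR : Tendsto (fun t => pressureRate γ μ (traj γ μ u τ t)) (𝓝[<] T)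
      (𝓝 ((μ ^ 2 - 1 / 2) * (w - 0) + μ * d / 2)) :=
    ((hw.sub hv).const_mul _).add ((hd.const_mul μ).div_const 2)
  have hnot_nonpos : ¬ ∀ᶠ t in 𝓝[<] T, pressure γ μ (traj γ μ u τ t) ≤ 0 := by
    intro h
    obtain ⟨N, hN⟩ := exists_tail hT h
    obtain ⟨t, ht, htp⟩ := C.exists_pressure_pos N
    exact absurd (hN t ⟨ht.1, ht.2.trans (C.startTime_lt hT _)⟩) (not_le.2 htp)
  -- The sign of the pressure just before `T` is read off from its limit, then from the limit `B` of
  -- its rate, and at worst from the second order.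
  rcases lt_trichotomy (2 * γ - d / 2 - μ * w) 0 with hA0 | hA0 | hA0
  · exact hnot_nonpos ((hA.eventually (gt_mem_nhds hA0)).mono fun t ht => ht.le)
  · rw [hA0] at hA
    set B := (μ ^ 2 - 1 / 2) * (w - 0) + μ * d / 2 with hB
    rcases lt_trichotomy B 0 with hB0 | hB0 | hB0
    · obtain ⟨N, hN⟩ := exists_tail hT (hR.eventually (gt_mem_nhds (show B < B / 2 by linarith)))
      refine C.false_of_pressureRate_neg hT hγ hμ (c := -B / (2 * T))
        (div_pos (by linarith) (by linarith)) hA (N := N) fun t ht => (hN t ht).le.trans ?_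
      have ht0 : 0 ≤ t := (C.startTime_nonneg _).trans ht.1
      have h1 : -(-B / (2 * T)) * (T - t) = B / 2 + (-B) * t / (2 * T) := by field_simp; ring
      have h2 : 0 ≤ (-B) * t / (2 * T) :=
        div_nonneg (mul_nonneg (by linarith) ht0) (by linarith)
      linarith
    -- Doubly degenerate case: vanishing pressure and rate force `w = 4 * μ * γ` and `d = 4 * γ - 2
    -- * μ * w`. The rate jumps with the lower velocity, so only its continuous part `b` is
    -- differentiated; `b'` tends to `γ > 0`, whence `b ≤ -γ / 2 * (T - t)`.
    · set κ := μ ^ 2 - 1 / 2 with hκ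
      have hacc : Tendsto (fun t => accel γ μ (traj γ μ u τ t)) (𝓝[<] T) (𝓝 0) := by
        have := hA.neg.sub (hv.const_mul μ)
        simp only [mul_zero, neg_zero, sub_zero] at this
        exact this.congr fun t => (accel_eq γ μ _).symm
      set b : ℝ → ℝ := fun t => κ * traj γ μ u τ t 3 + μ * stretch γ (traj γ μ u τ t) / 2 with hb
      have hblim : Tendsto b (𝓝[<] T) (𝓝 0) := by
        have : Tendsto b (𝓝[<] T) (𝓝 (κ * w + μ * d / 2)) :=
          (hw.const_mul κ).add ((hd.const_mul μ).div_const 2)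
        rwa [show κ * w + μ * d / 2 = 0 by rw [← hB0, hB]; ring] at this
      set b' : ℝ → ℝ := fun t => κ * (-stretch γ (traj γ μ u τ t) / 2 -
        μ * (traj γ μ u τ t 3 - traj γ μ u τ t 1)) +
        μ * (traj γ μ u τ t 3 - traj γ μ u τ t 1) / 2 with hb'
      have hb'lim : Tendsto b' (𝓝[<] T) (𝓝 γ) := by
        have h : Tendsto b' (𝓝[<] T) (𝓝 (κ * (-d / 2 - μ * (w - 0)) + μ * (w - 0) / 2)) :=
          (((hd.neg.div_const 2).sub ((hw.sub hv).const_mul μ)).const_mul κ).add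
            (((hw.sub hv).const_mul μ).div_const 2)
        have hw' : w = 4 * μ * γ := by
          rw [hB, hκ] at hB0
          linear_combination (-2) * hB0 - 2 * μ * hA0
        have hd' : d = 4 * γ - 2 * μ * w := by linear_combination (-2) * hA0
        have : κ * (-d / 2 - μ * (w - 0)) + μ * (w - 0) / 2 = γ := by
          rw [hκ, hd', hw']; ring
        rwa [this] at h
      -- With acceleration below this bound, the discontinuous part `κ * v` of the rate is at most
      -- `γ / 4 * (T - t)`, half of what `b` provides.
      have hε : 0 < γ / (4 * (|κ| + 1)) := by positivity
      obtain ⟨N, hN⟩ := exists_tail hT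
        ((hb'lim.eventually (lt_mem_nhds (show γ / 2 < γ by linarith))).and
          (hacc.abs.eventually (gt_mem_nhds (by simpa using hε))))
      have hvN := C.abs_velocity_le hT fun t ht => (hN t ht).2.le
      refine C.false_of_pressureRate_neg hT hγ hμ (c := γ / 4) (by positivity) hA (N := N)
        fun t ht => ?_
      have h1 := le_limit_of_right_deriv_nonneg (l := 0) (f := fun t => b t + γ / 2 * (T - t))
        (f' := fun t => b' t + γ / 2 * (-1))
        (fun s hs => (((C.tail_continuousOn hT C.continuousOn_upper_velocity s hs).const_mul κ).add
          (((C.tail_continuousOn hT C.continuousOn_stretch s hs).const_mul μ).div_const 2)).add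
          (by fun_prop))
        (fun s hs => by
          have hds := C.tail_hasDerivWithinAt hT s hs
          exact (((hasDerivWithinAt_upper_velocity hds).const_mul κ).add
            (((hasDerivWithinAt_stretch hds).const_mul μ).div_const 2)).add
            (((hasDerivWithinAt_id s _).const_sub T).const_mul (γ / 2)))
        (fun s hs => by linarith [(hN s hs).1])
        (by
          have h1 : Tendsto (fun t => γ / 2 * (T - t)) (𝓝[<] T) (𝓝 (γ / 2 * (T - T))) :=
            ((by fun_prop : Continuous fun t => γ / 2 * (T - t)).tendsto T).mono_left
              nhdsWithin_le_nhds
          simpa using hblim.add h1) ht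
      have h2 : |κ * traj γ μ u τ t 1| ≤ γ / 4 * (T - t) := by
        rw [abs_mul]
        have hTt : 0 ≤ T - t := sub_nonneg.2 ht.2.le
        calc |κ| * |traj γ μ u τ t 1| ≤ (|κ| + 1) * (γ / (4 * (|κ| + 1)) * (T - t)) :=
              mul_le_mul (by linarith) (hvN t ht) (abs_nonneg _) (by positivity)
          _ = γ / 4 * (T - t) := by field_simp
      have h3 : pressureRate γ μ (traj γ μ u τ t) = b t - κ * traj γ μ u τ t 1 := by
        simp only [pressureRate, hb, hκ]; ring
      rw [h3]
      have h4 := (abs_le.1 h2).1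
      linarith
    · refine hnot_nonpos ?_
      obtain ⟨N, hN⟩ := exists_tail hT (hR.eventually (lt_mem_nhds hB0))
      filter_upwards [Ico_mem_nhdsLT (C.startTime_lt hT (N + 1))] with t ht
      exact le_limit_of_right_deriv_nonneg (C.tail_continuousOn hT C.continuousOn_pressure)
        (fun s hs => hasDerivWithinAt_pressure (C.tail_hasDerivWithinAt hT s hs))
        (fun s hs => (hN s hs).le) hA ht
  · set A := 2 * γ - d / 2 - μ * w with hAdef
    set B := (μ ^ 2 - 1 / 2) * (w - 0) + μ * d / 2
    obtain ⟨N, hN⟩ := exists_tail hT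
      ((hA.eventually (lt_mem_nhds (show A / 2 < A by linarith))).and
        (hR.eventually (gt_mem_nhds (show B < |B| + 1 by linarith [le_abs_self B]))))
    refine C.false_of_pressure_pos hT hγ hμ (c := (|B| + 1) / (A / 2)) (by positivity) (N := N)
      (fun t ht => by linarith [(hN t ht).1]) fun t ht => ?_
    refine (hN t ht).2.le.trans ?_
    calc |B| + 1 = (|B| + 1) / (A / 2) * (A / 2) := by field_simp
      _ ≤ _ := mul_le_mul_of_nonneg_left (hN t ht).1.le (by positivity)

omit hT in
theorem tendsto_startTime (hγ : 0 < γ) (hμ : 0 < μ) : Tendsto (startTime τ) atTop atTop := by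
  rcases tendsto_atTop_of_monotone C.strictMono_startTime.monotone with h | ⟨T, hT⟩
  · exact h
  · exact (C.false_of_tendsto hT hγ hμ).elim

end IsChain

/-! ### Decay of the energy to zero along a chain -/

theorem abs_sub_le_of_right_deriv {f f' g g' : ℝ → ℝ} {a b : ℝ} (hf : ContinuousOn f (Icc a b))
    (hg : ContinuousOn g (Icc a b)) (hf' : ∀ t ∈ Ico a b, HasDerivWithinAt f (f' t) (Ici t) t)
    (hg' : ∀ t ∈ Ico a b, HasDerivWithinAt g (g' t) (Ici t) t)
    (h : ∀ t ∈ Ico a b, |f' t| ≤ g' t) {t : ℝ} (ht : t ∈ Icc a b) : |f t - f a| ≤ g t - g a := by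
  have hsub : Icc a t ⊆ Icc a b := Icc_subset_Icc_right ht.2
  have hm : ∀ r ∈ Ico a t, r ∈ Ico a b := fun r hr => ⟨hr.1, hr.2.trans_le ht.2⟩
  have h1 := le_of_right_deriv_nonneg ht.1 ((hg.mono hsub).add (hf.mono hsub))
    (fun r hr => (hg' r (hm r hr)).add (hf' r (hm r hr)))
    (fun r hr => by linarith [(abs_le.1 (h r (hm r hr))).1])
  have h2 := le_of_right_deriv_nonneg ht.1 ((hg.mono hsub).sub (hf.mono hsub))
    (fun r hr => (hg' r (hm r hr)).sub (hf' r (hm r hr)))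
    (fun r hr => by linarith [(abs_le.1 (h r (hm r hr))).2])
  simp only [Pi.add_apply, Pi.sub_apply] at h1 h2
  rw [abs_le]; constructor <;> linarith

theorem energy_nonneg {γ : ℝ} (hγ : 0 < γ) {v : State} (hv : 0 ≤ v 0) : 0 ≤ energy γ v := by
  have := mul_nonneg hγ.le hv
  unfold energy; positivity

theorem energy_lt_of_small {γ ρ δ : ℝ} (hγ : 0 < γ) (hρ : 0 < ρ) (hρ1 : ρ ≤ 1)
    (hρδ : (15 + 6 * γ) * ρ ≤ δ) {v : State} (h0 : v 0 ≤ 3 * ρ) (h1 : |v 1| ≤ 4 * ρ)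
    (h3 : |v 3| ≤ 3 * ρ) (h2 : |stretch γ v| ≤ 2 * ρ) : energy γ v < δ := by
  have e0 := mul_le_mul_of_nonneg_left h0 hγ.le
  have e1 : v 1 ^ 2 ≤ (4 * ρ) ^ 2 := sq_le_sq' (by linarith [(abs_le.1 h1).1]) (abs_le.1 h1).2
  have e3 : v 3 ^ 2 ≤ (3 * ρ) ^ 2 := sq_le_sq' (by linarith [(abs_le.1 h3).1]) (abs_le.1 h3).2
  have e2 : stretch γ v ^ 2 ≤ (2 * ρ) ^ 2 :=
    sq_le_sq' (by linarith [(abs_le.1 h2).1]) (abs_le.1 h2).2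
  have e4 : ρ ^ 2 ≤ ρ := by nlinarith
  unfold energy
  nlinarith

/-- A function that is close to a quadratic polynomial and bounded on a long interval has small
coefficients. -/
theorem coefficients_small_of_bounded {ρ M L d w x y : ℝ} (hρ1 : ρ ≤ 1) (hL1 : 1 ≤ L)
    (hL : 16 * M + 24 ≤ ρ * L) (hx : 0 ≤ x ∧ x ≤ M) (hy : 0 ≤ y ∧ y ≤ M)
    (hxq : |x - w * L + d * L ^ 2 / 4| ≤ ρ) (hyq : |y - w * (L / 2) + d * (L / 2) ^ 2 / 4| ≤ ρ) :
    |d| ≤ ρ ∧ |w| ≤ ρ := by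
  have hL0 : 0 < L := by linarith
  rw [abs_le] at hxq hyq
  -- For the exact polynomial, `x - 2 * y = -d * L ^ 2 / 8` and `4 * y - x = w * L`.
  have h1 : |d * L ^ 2| ≤ 16 * M + 24 := by
    rw [abs_le]; constructor <;> linarith
  have h2 : |w * L| ≤ 16 * M + 24 := by
    rw [abs_le] at h1 ⊢; constructor <;> linarith
  rw [abs_mul, abs_of_pos (by positivity : 0 < L ^ 2)] at h1
  rw [abs_mul, abs_of_pos hL0] at h2
  have h3 : |d| * L ≤ |d| * L ^ 2 :=
    mul_le_mul_of_nonneg_left (le_self_pow₀ hL1 two_ne_zero) (abs_nonneg d)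
  exact ⟨le_of_mul_le_mul_right ((h3.trans h1).trans hL) hL0,
    le_of_mul_le_mul_right (h2.trans hL) hL0⟩

namespace IsChain

variable {γ μ : ℝ} {u : ℕ → State} {τ : ℕ → ℝ} (C : IsChain γ μ u τ)

include C

/-- The energy is nonincreasing and bounded below, so once it is within `ε` of its infimum any later
drop is small. Non-accumulation provides a contact after that time and room for the window. -/
theorem exists_small_energy_drop (hγ : 0 < γ) (hμ : 0 < μ) {ε : ℝ} (hε : 0 < ε) (L : ℝ)
    (hL : 0 ≤ L) : ∃ n, energy γ (traj γ μ u τ (startTime τ (n + 1))) -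
      energy γ (traj γ μ u τ (startTime τ (n + 1) + L)) ≤ ε := by
  have htop := C.tendsto_startTime hγ hμ
  have hex : ∀ t : ℝ, ∃ N, t < startTime τ N := fun t => (htop.eventually_gt_atTop t).exists
  let S := (fun t => energy γ (traj γ μ u τ t)) '' Ici 0
  have hbdd : BddBelow S := by
    refine ⟨0, ?_⟩
    rintro _ ⟨t, ht, rfl⟩
    obtain ⟨N, hN⟩ := hex t
    exact energy_nonneg hγ (C.traj_height_nonneg ht hN)
  have hne : S.Nonempty := ⟨_, 0, self_mem_Ici, rfl⟩
  obtain ⟨_, ⟨t, ht, rfl⟩, hlt⟩ := exists_lt_of_csInf_lt hne (lt_add_of_pos_right (sInf S) hε)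
  obtain ⟨n, hn⟩ := hex t
  have hn1 := hn.trans (C.mem_start n).2
  refine ⟨n, ?_⟩
  have h1 := C.energy_antitone hμ ht hn1.le le_rfl
  have h2 := csInf_le hbdd ⟨startTime τ (n + 1) + L,
    add_nonneg (C.startTime_nonneg (n + 1)) hL, rfl⟩
  simp only at hlt h2
  linarith

set_option maxHeartbeats 800000 in
/-- The ball comes arbitrarily close to its rest position on the floor. -/
theorem exists_energy_lt (hγ : 0 < γ) (hμ : 0 < μ) {δ : ℝ} (hδ : 0 < δ) :
    ∃ n, energy γ (u n) < δ := by
  have htop := C.tendsto_startTime hγ hμ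
  set M := energy γ (u 0) / (2 * γ) with hM
  have hM0 : 0 ≤ M := div_nonneg (energy_nonneg hγ C.nonneg) (by positivity)
  obtain ⟨ρ, hρ, hρ1, hρδ⟩ : ∃ ρ > 0, ρ ≤ 1 ∧ (15 + 6 * γ) * ρ ≤ δ := by
    refine ⟨min 1 (δ / (15 + 6 * γ)), by positivity, min_le_left _ _, ?_⟩
    calc (15 + 6 * γ) * min 1 (δ / (15 + 6 * γ)) ≤ (15 + 6 * γ) * (δ / (15 + 6 * γ)) :=
          mul_le_mul_of_nonneg_left (min_le_right _ _) (by positivity)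
      _ = δ := by field_simp
  obtain ⟨L, hL1, hL⟩ : ∃ L, 1 ≤ L ∧ 16 * M + 24 ≤ ρ * L := by
    refine ⟨(16 * M + 24) / ρ + 1, le_add_of_nonneg_left (by positivity), ?_⟩
    rw [mul_add, mul_div_cancel₀ _ hρ.ne']
    linarith
  have hL0 : 0 < L := by linarith
  -- The product is exactly the error accumulated by the successive estimates of stretch, upper
  -- velocity and height over the window.
  obtain ⟨η, hη, hη3⟩ : ∃ η > 0, η * (L + 1) * (L ^ 2 / 2 + μ * L + 1) = ρ := by
    refine ⟨ρ / ((L + 1) * (L ^ 2 / 2 + μ * L + 1)), by positivity, ?_⟩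
    field_simp
  set η₁ := η * (L + 1) with hη₁
  have hη₁0 : 0 < η₁ := by positivity
  have hηL : 0 ≤ η₁ * (μ * L) := by positivity
  have hηL2 : η₁ * 1 ≤ η₁ * L ^ 2 := mul_le_mul_of_nonneg_left (by nlinarith) hη₁0.le
  have h2η : 3 * η ≤ ρ := by
    have : η * 1 ≤ η * L := mul_le_mul_of_nonneg_left hL1 hη.le
    nlinarith
  obtain ⟨n, hn⟩ := C.exists_small_energy_drop hγ hμ (ε := 4 * μ * η ^ 2) (by positivity) L hL0.le
  set a := startTime τ (n + 1) with ha
  set x := traj γ μ u τ with hx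
  have ha0 : 0 ≤ a := C.startTime_nonneg _
  obtain ⟨N, hN⟩ := (htop.eventually_gt_atTop (a + L)).exists
  have hsub : Icc a (a + L) ⊆ Icc 0 (startTime τ N) := Icc_subset_Icc ha0 hN.le
  have hX := (C.continuousOn_height N).mono hsub
  have hD := (C.continuousOn_stretch N).mono hsub
  have hW := (C.continuousOn_upper_velocity N).mono hsub
  have hE := (C.continuousOn_energy N).mono hsub
  have hd : ∀ t ∈ Ico a (a + L), HasDerivWithinAt x (freeField γ μ (x t)) (Ici t) t :=
    fun t ht => C.traj_hasDerivWithinAt (ha0.trans ht.1) (ht.2.trans hN)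
  have hxa : x a 0 = 0 := by rw [hx, ha, C.traj_startTime, C.succ_floor]
  have hEL : ∀ t ∈ Icc a (a + L), energy γ (x a) - energy γ (x t) ≤ 4 * μ * η ^ 2 := by
    intro t ht
    have := C.energy_antitone hμ (ha0.trans ht.1) ht.2 hN.le
    linarith
  have hXM : ∀ t ∈ Icc a (a + L), 0 ≤ x t 0 ∧ x t 0 ≤ M := by
    intro t ht
    have h1 := C.traj_height_nonneg (ha0.trans ht.1) (ht.2.trans_lt hN)
    refine ⟨h1, ?_⟩
    have h2 := C.energy_antitone hμ le_rfl (ha0.trans ht.1) (ht.2.trans hN.le)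
    have h00 : traj γ μ u τ 0 = u 0 := by
      have := C.traj_startTime 0
      rwa [startTime_zero] at this
    rw [h00] at h2
    rw [hM, le_div_iff₀ (by positivity)]
    have h3 : x t 0 * (2 * γ) ≤ energy γ (x t) := by
      unfold energy
      nlinarith [sq_nonneg (x t 1), sq_nonneg (x t 3), sq_nonneg (stretch γ (x t))]
    exact h3.trans h2
  have hDa : ∀ t ∈ Icc a (a + L), |stretch γ (x t) - stretch γ (x a)| ≤ η₁ := by
    intro t ht
    -- The relative velocity `z` satisfies `|z| ≤ η + z ^ 2 / (4 * η)`, and the quadratic term is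
    -- paid for by dissipated energy.
    refine (abs_sub_le_of_right_deriv (g := fun t => η * t - energy γ (x t) / (4 * μ * η))
      (g' := fun t => η * 1 - -μ * (x t 3 - x t 1) ^ 2 / (4 * μ * η)) hD
      ((by fun_prop : Continuous fun t => η * t).continuousOn.sub (hE.div_const _))
      (fun r hr => hasDerivWithinAt_stretch (hd r hr))
      (fun r hr => ((hasDerivWithinAt_id r _).const_mul η).sub
        ((hasDerivWithinAt_energy (hd r hr)).div_const _)) (fun r hr => ?_) ht).trans ?_
    · have h1 : η * 1 - -μ * (x r 3 - x r 1) ^ 2 / (4 * μ * η) =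
          (4 * η ^ 2 + (x r 3 - x r 1) ^ 2) / (4 * η) := by field_simp; ring
      rw [h1, le_div_iff₀ (by positivity)]
      nlinarith [sq_nonneg (|x r 3 - x r 1| - 2 * η), sq_abs (x r 3 - x r 1)]
    · have h1 : (energy γ (x a) - energy γ (x t)) / (4 * μ * η) ≤ η := by
        rw [div_le_iff₀ (by positivity)]
        linarith [hEL t ht]
      rw [sub_div] at h1
      have h2 : η * (t - a) ≤ η * L := mul_le_mul_of_nonneg_left (by linarith [ht.2]) hη.le
      rw [hη₁]
      linarith
  have hWa : ∀ t ∈ Icc a (a + L), |x t 3 - x a 3 + stretch γ (x a) * (t - a) / 2| ≤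
      η₁ * (L / 2 + μ) := by
    intro t ht
    -- Adding `μ * stretch` to the upper velocity cancels the dashpot term in the derivative.
    have h1 := abs_sub_le_of_right_deriv
      (f := fun t => x t 3 + μ * stretch γ (x t) + stretch γ (x a) / 2 * (t - a))
      (f' := fun t => -stretch γ (x t) / 2 - μ * (x t 3 - x t 1) + μ * (x t 3 - x t 1) +
        stretch γ (x a) / 2 * 1)
      (g := fun t => η₁ / 2 * t) (g' := fun _ => η₁ / 2 * 1)
      ((hW.add (continuousOn_const.mul hD)).add (by fun_prop)) (by fun_prop)
      (fun r hr => ((hasDerivWithinAt_upper_velocity (hd r hr)).add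
        ((hasDerivWithinAt_stretch (hd r hr)).const_mul μ)).add
        (((hasDerivWithinAt_id r _).sub_const a).const_mul _))
      (fun r _ => (hasDerivWithinAt_id r _).const_mul _)
      (fun r hr => by
        have := abs_le.1 (hDa r ⟨hr.1, hr.2.le⟩)
        rw [abs_le]; constructor <;> linarith) ht
    have h2 := abs_le.1 h1
    have h3 := abs_le.1 (hDa t ht)
    have h4 : η₁ * (t - a) ≤ η₁ * L := mul_le_mul_of_nonneg_left (by linarith [ht.2]) hη₁0.le
    have h5 := mul_le_mul_of_nonneg_left h3.1 hμ.le
    have h6 := mul_le_mul_of_nonneg_left h3.2 hμ.le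
    rw [abs_le]; constructor <;> linarith
  have hXa : ∀ t ∈ Icc a (a + L),
      |x t 0 - x a 3 * (t - a) + stretch γ (x a) * (t - a) ^ 2 / 4| ≤ ρ := by
    intro t ht
    -- Height plus stretch has derivative `x t 3`, which was just estimated, whereas the lower
    -- velocity is not yet controlled.
    have h1 := abs_sub_le_of_right_deriv
      (f := fun t => x t 0 + stretch γ (x t) - x a 3 * (t - a) + stretch γ (x a) / 4 * (t - a) ^ 2)
      (f' := fun t => x t 1 + (x t 3 - x t 1) - x a 3 * 1 +
        stretch γ (x a) / 4 * (2 * (t - a)))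
      (g := fun t => η₁ * (L / 2 + μ) * t) (g' := fun _ => η₁ * (L / 2 + μ) * 1)
      (((hX.add hD).sub (by fun_prop)).add (by fun_prop)) (by fun_prop)
      (fun r hr => (((hasDerivWithinAt_height (hd r hr)).add
        (hasDerivWithinAt_stretch (hd r hr))).sub
        (((hasDerivWithinAt_id r _).sub_const a).const_mul _)).add (by
          have := ((((hasDerivAt_id r).sub_const a).pow 2).const_mul
            (stretch γ (x a) / 4)).hasDerivWithinAt (s := Ici r)
          refine this.congr_deriv ?_
          simp))
      (fun r _ => (hasDerivWithinAt_id r _).const_mul _)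
      (fun r hr => by
        have := abs_le.1 (hWa r ⟨hr.1, hr.2.le⟩)
        rw [abs_le]; constructor <;> linarith) ht
    have h2 := abs_le.1 h1
    have h3 := abs_le.1 (hDa t ht)
    have h4 : η₁ * (L / 2 + μ) * (t - a) ≤ η₁ * (L / 2 + μ) * L :=
      mul_le_mul_of_nonneg_left (by linarith [ht.2]) (by positivity)
    have h5 : η₁ * (L / 2 + μ) * L + η₁ = ρ := by rw [← hη3]; ring
    simp only [hxa] at h2
    rw [abs_le]; constructor <;> linarith
  have hend := hXa (a + L) ⟨by linarith, le_rfl⟩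
  have hmid := hXa (a + L / 2) ⟨by linarith, by linarith⟩
  have hendM := hXM (a + L) ⟨by linarith, le_rfl⟩
  have hmidM := hXM (a + L / 2) ⟨by linarith, by linarith⟩
  rw [add_sub_cancel_left] at hend hmid
  obtain ⟨hda1, hwa⟩ := coefficients_small_of_bounded hρ1 hL1 hL hendM hmidM hend hmid
  -- Otherwise the energy lost in unit time would be at least `μ * ρ ^ 2 ≥ 9 * μ * η ^ 2`, above the
  -- budget `4 * μ * η ^ 2`. At such a time the lower velocity is small as well.
  obtain ⟨t, ht, htv⟩ : ∃ t ∈ Ico a (a + 1), |x t 3 - x t 1| < ρ := by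
    by_contra! hcon
    have hs1 : a + 1 ≤ a + L := by linarith
    have h1 := le_of_right_deriv_nonpos (f := fun t => energy γ (x t) + μ * ρ ^ 2 * t)
      (f' := fun t => -μ * (x t 3 - x t 1) ^ 2 + μ * ρ ^ 2 * 1) (show a ≤ a + 1 by linarith)
      ((hE.mono (Icc_subset_Icc_right hs1)).add (by fun_prop))
      (fun r hr => (hasDerivWithinAt_energy (hd r ⟨hr.1, hr.2.trans_le hs1⟩)).add
        ((hasDerivWithinAt_id r _).const_mul _))
      (fun r hr => by
        have h2 : ρ ^ 2 ≤ (x r 3 - x r 1) ^ 2 := by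
          rw [← sq_abs (x r 3 - x r 1)]
          exact pow_le_pow_left₀ hρ.le (hcon r hr) 2
        have := mul_le_mul_of_nonneg_left h2 hμ.le
        linarith)
    have h3 := hEL (a + 1) ⟨by linarith, hs1⟩
    have h4 : μ * (9 * η ^ 2) ≤ μ * ρ ^ 2 := by
      refine mul_le_mul_of_nonneg_left ?_ hμ.le
      nlinarith
    have h5 : 0 < μ * η ^ 2 := by positivity
    linarith
  have htL : t ∈ Icc a (a + L) := ⟨ht.1, by linarith [ht.2]⟩
  have hr0 : 0 ≤ t - a := by linarith [ht.1]
  have hr1 : t - a ≤ 1 := by linarith [ht.2]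
  have hη₁ρ : η₁ ≤ ρ := by nlinarith
  have hη₂ρ : η₁ * (L / 2 + μ) ≤ ρ := by
    have : η₁ * (L / 2 + μ) * 1 ≤ η₁ * (L / 2 + μ) * L :=
      mul_le_mul_of_nonneg_left hL1 (by positivity)
    nlinarith
  have e1 : |stretch γ (x a) * (t - a)| ≤ ρ := by
    rw [abs_mul, abs_of_nonneg hr0]
    exact (mul_le_of_le_one_right (abs_nonneg _) hr1).trans hda1
  have e2 : |stretch γ (x a) * (t - a) ^ 2| ≤ ρ := by
    rw [abs_mul, abs_of_nonneg (sq_nonneg (t - a))]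
    exact (mul_le_of_le_one_right (abs_nonneg _) (pow_le_one₀ hr0 hr1)).trans hda1
  have e3 : |x a 3 * (t - a)| ≤ ρ := by
    rw [abs_mul, abs_of_nonneg hr0]
    exact (mul_le_of_le_one_right (abs_nonneg _) hr1).trans hwa
  have f1 := abs_le.1 (hDa t htL)
  have f2 := abs_le.1 (hWa t htL)
  have f3 := abs_le.1 (hXa t htL)
  rw [abs_le] at e1 e2 e3 hda1 hwa
  rw [abs_lt] at htv
  have hlt : energy γ (x t) < δ := by
    refine energy_lt_of_small hγ hρ hρ1 hρδ (by linarith) ?_ ?_ ?_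
    all_goals rw [abs_le]; constructor <;> linarith
  refine ⟨N, ?_⟩
  have := C.energy_antitone hμ (ha0.trans ht.1) (htL.2.trans hN.le) le_rfl
  rw [C.traj_startTime] at this
  exact this.trans_lt hlt

end IsChain

/-! ### Openness of the settling sets -/

theorem isOpen_exists_flight {γ μ : ℝ} {G : Set State} (hG : IsOpen G) :
    IsOpen {u | ∃ τ, IsFlight γ μ u τ ∧ reflect (flow γ μ τ u) ∈ G} := by
  rw [isOpen_iff_mem_nhds]
  rintro u ⟨τ, hf, hτG⟩
  have hc := continuous_flow γ μ
  have hO : {q : ℝ × State | flow γ μ q.1 q.2 1 < 0 ∧ reflect (flow γ μ q.1 q.2) ∈ G} ∈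
      𝓝 (τ, u) := by
    refine IsOpen.mem_nhds ?_ ⟨hf.down, hτG⟩
    exact (isOpen_lt ((continuous_apply 1).comp hc) continuous_const).inter
      (hG.preimage (continuous_reflect.comp hc))
  obtain ⟨U, hU, V, hV, hUV⟩ := mem_nhds_prod_iff.1 hO
  obtain ⟨ε, hε, hεU⟩ := Metric.mem_nhds_iff.1 hU
  obtain ⟨η, hη, hηε, hητ⟩ : ∃ η > 0, η < ε ∧ η < τ :=
    ⟨min ε τ / 2, by have := hf.pos; positivity,
      by linarith [min_le_left ε τ, lt_min hε hf.pos],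
      by linarith [min_le_right ε τ, lt_min hε hf.pos]⟩
  have hIU : ∀ s ∈ Icc (τ - η) (τ + η), s ∈ U := by
    intro s hs
    refine hεU ?_
    rw [Metric.mem_ball, Real.dist_eq, abs_lt]
    constructor <;> linarith [hs.1, hs.2]
  -- Transversality persists: nearby states descend strictly around time `τ`, so they land exactly
  -- once there; compactness of `[0, τ - η]` keeps them airborne before.
  have hanti : ∀ v ∈ V, StrictAntiOn (fun s => flow γ μ s v 0) (Icc (τ - η) (τ + η)) := by
    intro v hv
    refine strictAntiOn_of_hasDerivWithinAt_neg (convex_Icc _ _)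
      (continuous_flow_coord γ μ v 0).continuousOn
      (fun s _ => hasDerivWithinAt_height (flow_hasDerivWithinAt γ μ s v _)) fun s hs => ?_
    exact (hUV (mk_mem_prod (hIU s (interior_subset hs)) hv)).1
  have hmid : τ ∈ Icc (τ - η) (τ + η) := ⟨by linarith, by linarith⟩
  have hleft : τ - η ∈ Icc (τ - η) (τ + η) := ⟨le_rfl, by linarith⟩
  have hright : τ + η ∈ Icc (τ - η) (τ + η) := ⟨by linarith, le_rfl⟩
  have hu := hanti u (mem_of_mem_nhds hV)
  have h1 : 0 < flow γ μ (τ - η) u 0 := by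
    have := hu hleft hmid (by linarith)
    simpa [hf.floor] using this
  have h2 : flow γ μ (τ + η) u 0 < 0 := by
    have := hu hmid hright (by linarith)
    simpa [hf.floor] using this
  have hcs : ∀ s, Continuous fun v => flow γ μ s v 0 := fun s =>
    (continuous_apply 0).comp (hc.comp (continuous_const.prodMk continuous_id))
  have hair : ∀ᶠ v in 𝓝 u, ∀ s ∈ Icc 0 (τ - η), flow γ μ s v ∈ airborne := by
    refine isCompact_Icc.eventually_forall_of_forall_eventually fun s hs => ?_
    exact ((isOpen_airborne.preimage (hc.comp continuous_swap)).mem_nhds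
      (hf.mem s ⟨hs.1, by linarith [hs.2]⟩))
  filter_upwards [hV, hair, (hcs (τ - η)).continuousAt.eventually (lt_mem_nhds h1),
    (hcs (τ + η)).continuousAt.eventually (gt_mem_nhds h2)] with v hvV hva hv1 hv2
  obtain ⟨r, hr, hr0⟩ := intermediate_value_Icc' (show τ - η ≤ τ + η by linarith)
    (continuous_flow_coord γ μ v 0).continuousOn ⟨hv2.le, hv1.le⟩
  have hrO := hUV (mk_mem_prod (hIU r hr) hvV)
  refine ⟨r, ⟨by linarith [hr.1], fun s hs => ?_, hr0, hrO.1⟩, hrO.2⟩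
  rcases le_total s (τ - η) with h | h
  · exact hva s ⟨hs.1, h⟩
  · left
    have := hanti v hvV ⟨h, hs.2.le.trans hr.2⟩ hr hs.2
    simp only [hr0] at this
    exact this

/-- The states from which the energy drops below `δ` after `k` flights. -/
def settling (γ μ δ : ℝ) : ℕ → Set State
  | 0 => {u | u ∈ airborne ∧ energy γ u < δ}
  | k + 1 => {u | ∃ τ, IsFlight γ μ u τ ∧ reflect (flow γ μ τ u) ∈ settling γ μ δ k}

theorem isOpen_settling (γ μ δ : ℝ) (k : ℕ) : IsOpen (settling γ μ δ k) := by
  induction k with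
  | zero => exact isOpen_airborne.inter (isOpen_lt (continuous_energy γ) continuous_const)
  | succ k ih => exact isOpen_exists_flight ih

/-- The union of the settling sets is preserved by flights: the index counts down to zero and then
stays there, low energy supplying the next flight. Thus an open condition yields infinitely many
transversal landings. -/
theorem exists_chain_of_settling {γ μ δ : ℝ} (hγ : 0 < γ) (hμ : 0 < μ)
    (hδ : ∀ u : State, 0 ≤ u 0 → energy γ u < δ → accel γ μ u < 0) {u₀ : State} (h0 : 0 ≤ u₀ 0)
    {k : ℕ} (hk : u₀ ∈ settling γ μ δ k) : ∃ u τ, IsChain γ μ u τ ∧ u 0 = u₀ := by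
  refine exists_chain (S := {u | 0 ≤ u 0 ∧ ∃ k, u ∈ settling γ μ δ k}) ?_ ⟨h0, k, hk⟩ h0
  rintro u ⟨hu0, k, hu⟩
  cases k with
  | zero =>
    obtain ⟨τ, hf, hE⟩ := exists_chain_of_energy_lt hγ hμ hδ hu0 hu.1 hu.2
    exact ⟨τ, hf, by simp [hf.floor], 0, reflect_mem_airborne hf, hE⟩
  | succ k =>
    obtain ⟨τ, hf, h⟩ := hu
    exact ⟨τ, hf, by simp [hf.floor], k, h⟩

theorem IsChain.exists_settling {γ μ δ : ℝ} (hγ : 0 < γ) (hμ : 0 < μ) (hδ : 0 < δ)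
    {u : ℕ → State} {τ : ℕ → ℝ} (C : IsChain γ μ u τ) : ∃ k, u 0 ∈ settling γ μ δ k := by
  obtain ⟨n, hn⟩ := C.exists_energy_lt hγ hμ hδ
  have key : ∀ j m, m + j = n → u m ∈ settling γ μ δ j := by
    intro j
    induction j with
    | zero =>
      rintro m rfl
      have := (C.flight m).mem 0 ⟨le_rfl, (C.flight m).pos⟩
      rw [flow_zero] at this
      exact ⟨this, hn⟩
    | succ j ih =>
      intro m hm
      refine ⟨τ m, C.flight m, ?_⟩
      rw [← C.next]
      exact ih (m + 1) (by omega)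
  exact ⟨n, key n 0 (zero_add n)⟩

/-! ### Every trajectory follows the chain -/

theorem tendsto_flow_sub (γ μ t : ℝ) {a : ℝ} {w : ℝ → State} {v : State}
    (hw : Tendsto w (𝓝[>] a) (𝓝 v)) :
    Tendsto (fun r => flow γ μ (t - r) (w r)) (𝓝[>] a) (𝓝 (flow γ μ (t - a) v)) := by
  have h1 : Tendsto (fun r => t - r) (𝓝[>] a) (𝓝 (t - a)) :=
    ((continuous_const.sub continuous_id).tendsto a).mono_left nhdsWithin_le_nhds
  have h2 := ((continuous_flow γ μ).tendsto (t - a, v)).comp (h1.prodMk_nhds hw)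
  simp only [Function.comp_def] at h2
  exact h2

namespace IsTrajectory

variable {γ μ T : ℝ} {u₀ : State} {w : ℝ → State} (hw : IsTrajectory γ μ u₀ T w)

include hw

/-- At `a` itself the equation may fail, so uniqueness is applied from `r > a` and then `r → a` by
right continuity. -/
theorem eq_flow_of_pos {a b : ℝ} (ha : 0 ≤ a) (hb : b ≤ T) (hpos : ∀ t ∈ Ioo a b, 0 < w t 0) :
    ∀ t ∈ Ico a b, w t = flow γ μ (t - a) (w a) := by
  intro t ht
  rcases ht.1.eq_or_lt with rfl | hat
  · rw [sub_self, flow_zero]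
  have h1 : ∀ r ∈ Ioo a t, w t = flow γ μ (t - r) (w r) := by
    intro r hr
    have hd : ∀ s ∈ Icc r t, HasDerivAt w (freeField γ μ (w s)) s := fun s hs =>
      hw.free s ⟨ha.trans_lt (hr.1.trans_le hs.1), (hs.2.trans_lt ht.2).trans_le hb⟩
        (hpos s ⟨hr.1.trans_le hs.1, hs.2.trans_lt ht.2⟩)
    exact flow_unique (fun s hs => (hd s hs).continuousAt.continuousWithinAt)
      (fun s hs => (hd s ⟨hs.1, hs.2.le⟩).hasDerivWithinAt) t ⟨hr.2.le, le_rfl⟩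
  have hwa : Tendsto w (𝓝[>] a) (𝓝 (w a)) :=
    (hw.right_cont a ⟨ha, hat.trans (ht.2.trans_le hb)⟩).tendsto.mono_left
      (nhdsWithin_mono a Ioi_subset_Ici_self)
  have h2 : ∀ᶠ r in 𝓝[>] a, w t = flow γ μ (t - r) (w r) := by
    filter_upwards [Ioo_mem_nhdsGT hat] with r hr using h1 r hr
  exact tendsto_nhds_unique (tendsto_const_nhds.congr' h2) (tendsto_flow_sub γ μ t hwa)

/-- At a contact with upward velocity, right continuity of the velocity excludes the resting
alternative. -/
theorem exists_pos_after {a : ℝ} (ha : a ∈ Ico 0 T) (hair : w a ∈ airborne) :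
    ∃ b > a, b ≤ T ∧ ∀ t ∈ Ioo a b, 0 < w t 0 := by
  have hcoord : ∀ i, ContinuousWithinAt (fun t => w t i) (Ici a) a := fun i =>
    continuousWithinAt_pi.1 (hw.right_cont a ha) i
  have hT : ∀ᶠ t in 𝓝[≥] a, t < T := nhdsWithin_le_nhds (gt_mem_nhds ha.2)
  by_cases h0 : 0 < w a 0
  · obtain ⟨b, hb, h⟩ := mem_nhdsGE_iff_exists_Ico_subset.1
      (((hcoord 0).tendsto.eventually (lt_mem_nhds h0)).and hT)
    refine ⟨min b T, lt_min hb ha.2, min_le_right _ _, fun t ht => ?_⟩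
    exact (h ⟨ht.1.le, ht.2.trans_le (min_le_left _ _)⟩).1
  · have h1 : 0 < w a 1 := hair.resolve_left h0
    have h00 : w a 0 = 0 := le_antisymm (not_lt.1 h0) (hw.nonneg a ha)
    obtain ⟨ε, hε, h | h⟩ := hw.after_contact a ha h00
    · refine ⟨min (a + ε) T, lt_min (by linarith) ha.2, min_le_right _ _, fun t ht => ?_⟩
      exact h t ⟨ht.1, ht.2.trans_le (min_le_left _ _)⟩ (ht.2.trans_le (min_le_right _ _))
    · obtain ⟨b, hb, hbs⟩ := mem_nhdsGE_iff_exists_Ico_subset.1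
        (((hcoord 1).tendsto.eventually (lt_mem_nhds h1)).and hT)
      obtain ⟨t, ht⟩ := exists_between (lt_min hb (show a < a + ε by linarith))
      have h2 := hbs ⟨ht.1.le, ht.2.trans_le (min_le_left _ _)⟩
      have h3 := h t ⟨ht.1, ht.2.trans_le (min_le_right _ _)⟩ h2.2
      exact absurd h2.1 (by simp [h3.2.1])

/-- At a first premature contact the left limit of the trajectory would be the flow, whose height is
still positive there. -/
theorem eq_flow_of_isFlight {a τ : ℝ} (ha : a ∈ Ico 0 T) (hf : IsFlight γ μ (w a) τ) :
    ∀ t ∈ Ico a (min (a + τ) T), w t = flow γ μ (t - a) (w a) := by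
  refine hw.eq_flow_of_pos ha.1 (min_le_right _ _) ?_
  by_contra! hcon
  set S := {t | t ∈ Ioo a (min (a + τ) T) ∧ w t 0 ≤ 0} with hS
  have hSne : S.Nonempty := hcon
  have hair : w a ∈ airborne := by
    have := hf.mem 0 ⟨le_rfl, hf.pos⟩
    rwa [flow_zero] at this
  obtain ⟨b, hab, hbT, hpos⟩ := hw.exists_pos_after ha hair
  have hlb : ∀ s ∈ S, b ≤ s := fun s hs => by
    by_contra! h
    exact absurd (hpos s ⟨hs.1.1, h⟩) (not_lt.2 hs.2)
  have hbdd : BddBelow S := ⟨b, hlb⟩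
  set c := sInf S with hc
  have hac : a < c := hab.trans_le (le_csInf hSne hlb)
  have hcb : c < min (a + τ) T := by
    obtain ⟨s, hs⟩ := hSne
    exact (csInf_le hbdd hs).trans_lt hs.1.2
  have hcT : c ∈ Ioo 0 T := ⟨ha.1.trans_lt hac, hcb.trans_le (min_le_right _ _)⟩
  have hbefore : ∀ t ∈ Ioo a c, 0 < w t 0 := by
    intro t ht
    by_contra! h
    exact absurd (csInf_le hbdd ⟨⟨ht.1, ht.2.trans hcb⟩, h⟩) (not_le.2 ht.2)
  have hc0 : w c 0 = 0 := by
    refine le_antisymm ?_ (hw.nonneg c ⟨hcT.1.le, hcT.2⟩)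
    by_contra! h
    have h1 : ∀ᶠ t in 𝓝[≥] c, 0 < w t 0 :=
      (continuousWithinAt_pi.1 (hw.right_cont c ⟨hcT.1.le, hcT.2⟩) 0).tendsto.eventually
        (lt_mem_nhds h)
    obtain ⟨d, hd, hds⟩ := mem_nhdsGE_iff_exists_Ico_subset.1 h1
    obtain ⟨s, hs, hsd⟩ := exists_lt_of_csInf_lt hSne hd
    exact absurd (hds ⟨csInf_le hbdd hs, hsd⟩) (not_lt.2 hs.2)
  have hflow := hw.eq_flow_of_pos ha.1 hcT.2.le hbefore
  have hlim : Tendsto w (𝓝[<] c) (𝓝 (flow γ μ (c - a) (w a))) := by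
    have h1 : Tendsto (fun t => flow γ μ (t - a) (w a)) (𝓝[<] c) (𝓝 (flow γ μ (c - a) (w a))) :=
      (((continuous_flow_time γ μ (w a)).comp (continuous_id.sub continuous_const)).tendsto
        c).mono_left nhdsWithin_le_nhds
    refine h1.congr' ?_
    filter_upwards [Ico_mem_nhdsLT hac] with t ht using (hflow t ht).symm
  have heq := congrFun (tendsto_nhds_unique hlim (hw.contact c hcT hc0)) 0
  have hlt : c < a + τ := hcb.trans_le (min_le_left _ _)
  have := flow_height_pos (hw.nonneg a ha) hf.mem (c - a) ⟨by linarith, by linarith⟩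
  rw [heq, reflect_zero, hc0] at this
  exact lt_irrefl 0 this

theorem tendsto_of_isFlight {a τ : ℝ} (ha : a ∈ Ico 0 T) (hf : IsFlight γ μ (w a) τ)
    (hT : a + τ < T) : Tendsto w (𝓝[<] (a + τ)) (𝓝 (flow γ μ τ (w a))) := by
  have h1 : Tendsto (fun t => flow γ μ (t - a) (w a)) (𝓝[<] (a + τ))
      (𝓝 (flow γ μ (a + τ - a) (w a))) :=
    (((continuous_flow_time γ μ (w a)).comp (continuous_id.sub continuous_const)).tendsto
      (a + τ)).mono_left nhdsWithin_le_nhds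
  rw [add_sub_cancel_left] at h1
  refine h1.congr' ?_
  filter_upwards [Ico_mem_nhdsLT (show a < a + τ by linarith [hf.pos])] with t ht
  exact (hw.eq_flow_of_isFlight ha hf t ⟨ht.1, lt_min ht.2 (ht.2.trans hT)⟩).symm

theorem eq_reflect_of_isFlight {a τ : ℝ} (ha : a ∈ Ico 0 T) (hf : IsFlight γ μ (w a) τ)
    (hT : a + τ < T) : w (a + τ) = reflect (flow γ μ τ (w a)) := by
  have hlim := hw.tendsto_of_isFlight ha hf hT
  have hmem : a + τ ∈ Ioo 0 T := ⟨by linarith [ha.1, hf.pos], hT⟩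
  rcases (hw.nonneg (a + τ) ⟨hmem.1.le, hT⟩).eq_or_lt with h | h
  · rw [tendsto_nhds_unique hlim (hw.contact _ hmem h.symm), reflect_reflect]
  · have h1 := tendsto_nhds_unique hlim
      ((hw.free _ hmem h).continuousAt.tendsto.mono_left nhdsWithin_le_nhds)
    rw [← h1, hf.floor] at h
    exact absurd h (lt_irrefl 0)

theorem eq_of_isChain {u : ℕ → State} {τ : ℕ → ℝ} (C : IsChain γ μ u τ) (h0 : w 0 = u 0) (n : ℕ)
    (hn : startTime τ n < T) : w (startTime τ n) = u n := by
  induction n with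
  | zero => rw [startTime_zero, h0]
  | succ n ih =>
    have hlt := (C.mem_start n).2.trans hn
    have ih := ih hlt
    have hf : IsFlight γ μ (w (startTime τ n)) (τ n) := by rw [ih]; exact C.flight n
    rw [startTime_succ] at hn ⊢
    rw [hw.eq_reflect_of_isFlight ⟨C.startTime_nonneg n, hlt⟩ hf hn, ih, C.next]

/-- By non-accumulation the flights cover all times. The height is positive inside each flight and
at time zero, so contacts occur only at landings, where the incoming velocity is negative. -/
theorem not_zeroVelocityContactAt {u : ℕ → State} {τ : ℕ → ℝ} (C : IsChain γ μ u τ)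
    (hγ : 0 < γ) (hμ : 0 < μ) (hu : u 0 = u₀) (hpos : 0 < u₀ 0) {t : ℝ} (ht : t ∈ Ico 0 T) :
    ¬ ZeroVelocityContactAt u₀ w t := by
  rintro ⟨htx, htv⟩
  have hw0 : w 0 = u 0 := by
    rw [hw.init, hu, startState, if_neg fun h => hpos.ne' h.1]
  obtain ⟨N, hN⟩ := ((C.tendsto_startTime hγ hμ).eventually_gt_atTop t).exists
  obtain ⟨n, -, hn⟩ := IsChain.exists_index τ ht.1 hN
  have hnT : startTime τ n < T := hn.1.trans_lt ht.2
  have hwn := hw.eq_of_isChain C hw0 n hnT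
  have hf : IsFlight γ μ (w (startTime τ n)) (τ n) := by rw [hwn]; exact C.flight n
  have hmem : startTime τ n ∈ Ico 0 T := ⟨C.startTime_nonneg n, hnT⟩
  rw [startTime_succ] at hn
  rcases hn.1.eq_or_lt with h | h
  · cases n with
    | zero =>
      rw [startTime_zero] at h
      rw [← h, hw0, hu] at htx
      exact hpos.ne' htx
    | succ m =>
      have hm := (C.mem_start m).2.trans hnT
      have hwm := hw.eq_of_isChain C hw0 m hm
      have hfm : IsFlight γ μ (w (startTime τ m)) (τ m) := by rw [hwm]; exact C.flight m
      have htpos : 0 < t := by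
        rw [← h]
        exact (C.startTime_nonneg m).trans_lt (C.mem_start m).2
      have htv := (htv.resolve_left fun h => htpos.ne' h.1).2
      have hlim := hw.tendsto_of_isFlight ⟨C.startTime_nonneg m, hm⟩ hfm
        (by rw [← startTime_succ]; exact hnT)
      rw [← startTime_succ, h] at hlim
      have h1 := tendsto_nhds_unique ((tendsto_pi_nhds.1 hlim) 1) htv
      exact hfm.down.ne h1
  · rw [hw.eq_flow_of_isFlight hmem hf t ⟨hn.1, lt_min hn.2 ht.2⟩] at htx
    have := flow_height_pos (hw.nonneg _ hmem) hf.mem (t - startTime τ n)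
      ⟨by linarith, by linarith [hn.2]⟩
    exact this.ne' htx

end IsTrajectory

/-! ### Conclusion: null and nowhere dense -/

/-- Take the settling states with positive height. Settling states have transversal chains, and a
state of positive height that never grazes has a chain, which settles; so only grazing states are
missed. -/
theorem exists_isOpen_disjoint_anomalous {γ μ : ℝ} (hγ : 0 < γ) (hμ : 0 < μ) :
    ∃ G : Set State, IsOpen G ∧ Disjoint G (anomalousInitialConditions γ μ) ∧
      volume ({u | 0 < u 0} \ G) = 0 := by
  obtain ⟨δ, hδ, hacc⟩ := exists_energy_lt_accel_neg hγ hμ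
  refine ⟨{u | 0 < u 0} ∩ ⋃ k, settling γ μ δ k,
    (isOpen_lt continuous_const (continuous_apply 0)).inter
      (isOpen_iUnion fun k => isOpen_settling γ μ δ k), ?_, ?_⟩
  · rw [Set.disjoint_left]
    rintro u₀ ⟨hpos, hu⟩ ⟨-, T, w, hw, t, ht, hz⟩
    obtain ⟨k, hk⟩ := mem_iUnion.1 hu
    obtain ⟨u, τ, C, rfl⟩ := exists_chain_of_settling hγ hμ hacc (le_of_lt hpos) hk
    exact hw.not_zeroVelocityContactAt C hγ hμ rfl hpos ht hz
  · refine measure_mono_null ?_ (measure_iUnion_null fun k => volume_grazing γ μ k)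
    rintro u₀ ⟨hpos, hu⟩
    by_contra hg
    rw [mem_iUnion, not_exists] at hg
    obtain ⟨u, τ, C, rfl⟩ := exists_chain_of_not_grazing hγ hμ (le_of_lt hpos) (Or.inl hpos) hg
    exact hu ⟨hpos, mem_iUnion.2 (C.exists_settling hγ hμ hδ)⟩

theorem volume_anomalousInitialConditions {γ μ : ℝ} {G : Set State}
    (hdisj : Disjoint G (anomalousInitialConditions γ μ))
    (hG : volume ({u | 0 < u 0} \ G) = 0) : volume (anomalousInitialConditions γ μ) = 0 := by
  refine measure_mono_null (fun u hu => ?_) (measure_union_null (volume_coordinate_eq 0 0) hG)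
  rcases (show 0 ≤ u 0 from hu.1).eq_or_lt with h | h
  · exact Or.inl h.symm
  · exact Or.inr ⟨h, fun hg => Set.disjoint_left.1 hdisj hg hu⟩

theorem isNowhereDense_anomalousInitialConditions {γ μ : ℝ} {G : Set State} (hGo : IsOpen G)
    (hdisj : Disjoint G (anomalousInitialConditions γ μ))
    (hG : volume ({u | 0 < u 0} \ G) = 0) :
    IsNowhereDense ((fun u₀ : Admissible => (u₀ : State)) ⁻¹' anomalousInitialConditions γ μ) := by
  set c : Admissible → State := fun u₀ => (u₀ : State)
  have hcl : closure (c ⁻¹' anomalousInitialConditions γ μ) ⊆ c ⁻¹' Gᶜ :=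
    closure_minimal (preimage_mono fun u hu hg => Set.disjoint_left.1 hdisj hg hu)
      (hGo.isClosed_compl.preimage continuous_subtype_val)
  refine eq_empty_of_forall_notMem fun v hv => ?_
  obtain ⟨O, hO, hOc⟩ := isOpen_induced_iff.1
    (isOpen_interior (s := closure (c ⁻¹' anomalousInitialConditions γ μ)))
  have hvO : (v : State) ∈ O := by
    have : v ∈ c ⁻¹' O := by rw [hOc]; exact hv
    exact this
  have hpos : IsOpen {u : State | 0 < u 0} := isOpen_lt continuous_const (continuous_apply 0)
  -- A relatively open set may touch the floor, so the point is lifted slightly; the open set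
  -- obtained has positive measure, yet lies in the null complement of `G`.
  have hne : (O ∩ {u : State | 0 < u 0}).Nonempty := by
    have hcont : Continuous fun r : ℝ => (v : State) + r • (Pi.single 0 1 : State) := by fun_prop
    have h1 : ∀ᶠ r in 𝓝[>] (0 : ℝ), (v : State) + r • (Pi.single 0 1 : State) ∈ O := by
      refine nhdsWithin_le_nhds (hcont.continuousAt.eventually (hO.mem_nhds ?_))
      simpa using hvO
    obtain ⟨r, hr, hr0⟩ := (h1.and self_mem_nhdsWithin).exists
    refine ⟨_, hr, ?_⟩
    have h2 : 0 ≤ (v : State) 0 := v.2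
    have h3 : 0 < r := hr0
    simp only [mem_ofPred_eq, Pi.add_apply, Pi.smul_apply, Pi.single_eq_same, smul_eq_mul, mul_one]
    linarith
  refine ((hO.inter hpos).measure_pos volume hne).ne' (measure_mono_null ?_ hG)
  rintro u ⟨huO, hu0⟩
  refine ⟨hu0, ?_⟩
  have hu : u ∈ Admissible := show 0 ≤ u 0 from le_of_lt hu0
  have hmem : (⟨u, hu⟩ : Admissible) ∈ c ⁻¹' O := huO
  rw [hOc] at hmem
  exact hcl (interior_subset hmem)

end BouncingBall

theorem theorem2 (γ μ : ℝ) (hγ : 0 < γ) (hμ : 0 < μ) :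
    volume (BouncingBall.anomalousInitialConditions γ μ) = 0 ∧
    IsNowhereDense ((fun u₀ : BouncingBall.Admissible => (u₀ : BouncingBall.State)) ⁻¹'
      BouncingBall.anomalousInitialConditions γ μ) := by
  obtain ⟨G, hGo, hdisj, hG⟩ := BouncingBall.exists_isOpen_disjoint_anomalous hγ hμ
  exact ⟨BouncingBall.volume_anomalousInitialConditions hdisj hG,
    BouncingBall.isNowhereDense_anomalousInitialConditions hGo hdisj hG⟩
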